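/- **Notation.** For $d\ge 1$ let $\mathbb S^d=\{x\in\mathbb R^{d+1}:\|x\|=1\}$ with surface area measure $\sigma_d$ and total area $\omega_d$. Let $C_k^{(d-1)/2}$ be the Gegenbauer polynomials for $d\ge 2$, let $C_k^0:=T_k$ be the Chebyshev polynomials of the first kind for $d=1$, and put $\tilde C_k^{(d-1)/2}(x)=C_k^{(d-1)/2}(x)/C_k^{(d-1)/2}(1)$. For $k\ge1$, $\mu\in\mathbb S^d$ and $\rho\in[-1,1]$, the spherical cardioid distribution $\mathrm C_k(\mu,\rho)$ on $\mathbb S^d$ has density $\frac1{\omega_d}\{1+\rho\,\tilde C_k^{(d-1)/2}(x^\top\mu)\}$ with respect to $\sigma_d$. For $\gamma\in\mathbb S^d$ let $F_\gamma$ be the distribution function of $\gamma^\top X$ when $X\sim \mathrm C_k(\mu,\rho)$. For $n\ge 1$ and a sample $X_1,\dots,X_n\in\mathbb S^d$ let $F_{n,\gamma}(x)=\frac1n\sum_{i=1}^n 1_{\{\gamma^\top X_i\le x\}}$. The statistic with Cramér–von Mises weight $\mathrm dW(u)=\mathrm du$ and uniformly distributed directions is $$P_n^{\mathrm{CvM},\mathrm{Unif}}=\frac{n}{\omega_d}\int_{\mathbb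 S^d}\int_{-1}^1\bigl(F_{n,\gamma}(x)-F_\gamma(x)\bigr)^2\,\mathrm dF_\gamma(x)\,\sigma_d(\mathrm d\gamma).$$ Write $\mu_i=X_i^\top\mu$, $t_{ij}=X_i^\top X_j$ and $$\psi_1^{\mathrm{CvM}}(\theta)=\frac12+\frac{\theta}{2\pi}\Bigl(\frac{\theta}{2\pi}-1\Bigr),\qquad \psi_2^{\mathrm{CvM}}(\theta)=\frac12-\frac14\sin\Bigl(\frac\theta2\Bigr).$$ **Theorem.** For all $n\ge1$, all $\rho\in[-1,1]$, all $\mu\in\mathbb S^d$ and all $X_1,\dots,X_n\in\mathbb S^d$, $$P_n^{\mathrm{CvM},\mathrm{Unif}}=\frac{3-2n}{6}-\sum_{i=1}^n\varphi(X_i)+\frac2n\sum_{1\le i<j\le n}\psi(X_i,X_j),$$ where the kernels are as follows. (i) If $d=1$ and $k\ge1$, $$\varphi(X_i)=\frac{\rho}{2\pi^2k^2}\Bigl\{T_k(\mu_i)-\frac\rho4\bigl(2-T_{2k}(\mu_i)\bigr)\Bigr\},$$ $$\psi(X_i,X_j)=\psi_1^{\mathrm{CvM}}(\cos^{-1}t_{ij})-\rho\,\frac{\pi-\cos^{-1}(t_{ij})}{2\pi^2k}\,T_k\Bigl(\frac{\mu_i+\mu_j}{\sqrt{2(1+t_{ij})}}\Bigr)\sin\Bigl(\frac{k\cos^{-1}(t_{ij})}{2}\Bigr).$$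 (ii) If $d=2$ and $k=1$, $$\varphi(X_i)=\frac{\rho}{30}\mu_i-\frac{\rho^2}{4}\Bigl\{\frac2{35}-\frac{4\mu_i^2}{105}\Bigr\},\qquad \psi(X_i,X_j)=\psi_2^{\mathrm{CvM}}(\cos^{-1}t_{ij})-\frac{\rho}{32}\sqrt{\frac{1-t_{ij}}2}\,(\mu_i+\mu_j).$$ (iii) If $d=2$ and $k=2$, $$\varphi(X_i)=\frac{\rho}{420}(3\mu_i^2-1)-\frac{\rho^2}{4}\Bigl\{\frac1{330}+\frac{3\mu_i^2}{385}-\frac{\mu_i^4}{110}\Bigr\},$$ $$\psi(X_i,X_j)=\psi_2^{\mathrm{CvM}}(\cos^{-1}t_{ij})+\frac{\rho}{128}\sqrt{\frac{1-t_{ij}}2}\Bigl\{\frac{1+t_{ij}}2+\frac{3(3t_{ij}-1)}{4(1-t_{ij})}\bigl[\mu_i^2+\mu_j^2\bigr]+\frac{3(t_{ij}-3)}{2(1-t_{ij})}\mu_i\mu_j\Bigr\}.$$ The term containing an undefined quotient (the second term of $\psi$ in (i) when $t_{ij}=-1$ and in (iii) when $t_{ij}=1$) is read as its limit $0$. -/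

import Mathlib

open MeasureTheory ProbabilityTheory Set
open scoped BigOperators RealInnerProductSpace

noncomputable section

namespace SphCardioid

/-- The unit sphere `S^d` of the Euclidean space `ℝ^(d+1)`. -/
abbrev Sph (d : ℕ) : Type :=
  Metric.sphere (0 : EuclideanSpace ℝ (Fin (d + 1))) 1

/-- The inner product `xᵀy` of two points of `S^d`. -/
def dot {d : ℕ} (x y : Sph d) : ℝ :=
  inner ℝ (x : EuclideanSpace ℝ (Fin (d + 1))) (y : EuclideanSpace ℝ (Fin (d + 1)))

/-- The surface area measure `σ_d` on `S^d`. -/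
def surface (d : ℕ) : Measure (Sph d) :=
  (volume : Measure (EuclideanSpace ℝ (Fin (d + 1)))).toSphere

/-- The surface area `ω_d` of `S^d`. -/
def area (d : ℕ) : ℝ := (surface d).real univ

/-- The uniform distribution on `S^d`, that is, `σ_d / ω_d`. -/
def unif (d : ℕ) : Measure (Sph d) := (surface d univ)⁻¹ • surface d

/-- The Gegenbauer polynomials `C_k^lam`, through their three-term recurrence. -/
def gegenbauer (lam : ℝ) : ℕ → ℝ → ℝ
  | 0, _ => 1
  | 1, x => 2 * lam * x
  | k + 2, x =>
      (2 * (k + 1 + lam) * x * gegenbauer lam (k + 1) x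
        - (k + 2 * lam) * gegenbauer lam k x) / (k + 2)

/-- The Chebyshev polynomial of the first kind, as a real function. -/
def cheb (k : ℕ) (x : ℝ) : ℝ := (Polynomial.Chebyshev.T ℝ k).eval x

/-- `C_k^((d-1)/2)`, with the convention `C_k^0 = T_k` when `d = 1`. -/
def sphPoly (d k : ℕ) (x : ℝ) : ℝ :=
  if d = 1 then cheb k x else gegenbauer (((d : ℝ) - 1) / 2) k x

/-- The normalized polynomial `C_k^((d-1)/2)(x) / C_k^((d-1)/2)(1)`. -/
def sphPolyNormalized (d k : ℕ) (x : ℝ) : ℝ := sphPoly d k x / sphPoly d k 1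

/-- The spherical cardioid distribution on `S^d` of order `k`, location `μ` and
concentration `ρ`, given by its density with respect to the surface area measure. -/
def cardioid (d k : ℕ) (μ : Sph d) (ρ : ℝ) : Measure (Sph d) :=
  (surface d).withDensity fun x =>
    ENNReal.ofReal (1 / area d * (1 + ρ * sphPolyNormalized d k (dot x μ)))

/-- The distribution function `F_γ` of `γᵀX` when `X` has the spherical cardioid distribution. -/
def projCdf (d k : ℕ) (μ : Sph d) (ρ : ℝ) (γ : Sph d) : StieltjesFunction ℝ :=
  cdf ((cardioid d k μ ρ).map fun x => dot γ x)

/-- The empirical distribution function `F_{n,γ}` of the projections `γᵀX_1, …, γᵀX_n`. -/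
def projEcdf {d n : ℕ} (X : Fin n → Sph d) (γ : Sph d) (x : ℝ) : ℝ :=
  1 / (n : ℝ) * ∑ i, (Iic x).indicator (fun _ => (1 : ℝ)) (dot γ (X i))

/-- The composition of two nondecreasing right-continuous functions. Its Lebesgue–Stieltjes
measure is `dW(F(x))`. -/
def stieltjesComp (W F : StieltjesFunction ℝ) : StieltjesFunction ℝ where
  toFun x := W (F x)
  mono' := fun _ _ h => W.mono (F.mono h)
  right_continuous' := fun x =>
    (W.right_continuous (F x)).comp (F.right_continuous x) fun _ hy => F.mono hy

/-- The projected statistic `P_n^{W,lam}`: for the weight with distribution function `W` and the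
distribution `lam` of the directions,
`n ∫ ∫_{[-1,1]} (F_{n,γ}(x) - F_γ(x))² dW(F_γ(x)) lam(dγ)`. -/
def projStat (W : StieltjesFunction ℝ) {d : ℕ} (lam : Measure (Sph d)) (k : ℕ) (μ : Sph d)
    (ρ : ℝ) {n : ℕ} (X : Fin n → Sph d) : ℝ :=
  n * ∫ γ, (∫ x in Icc (-1 : ℝ) 1, (projEcdf X γ x - projCdf d k μ ρ γ x) ^ 2
      ∂(stieltjesComp W (projCdf d k μ ρ γ)).measure) ∂lam

/-- The Cramér–von Mises weight `dW(u) = du`. -/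
def cvmWeight : StieltjesFunction ℝ := StieltjesFunction.id

/-- `P_n^{CvM,Unif}`. -/
def cvmUnifStat {d : ℕ} (k : ℕ) (μ : Sph d) (ρ : ℝ) {n : ℕ} (X : Fin n → Sph d) : ℝ :=
  projStat cvmWeight (unif d) k μ ρ X

/-- The Cramér–von Mises uniformity kernel on `S^1`. -/
def psiCvM₁ (θ : ℝ) : ℝ :=
  1 / 2 + θ / (2 * Real.pi) * (θ / (2 * Real.pi) - 1)

/-- The Cramér–von Mises uniformity kernel on `S^2`. -/
def psiCvM₂ (θ : ℝ) : ℝ :=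
  1 / 2 - 1 / 4 * Real.sin (θ / 2)

/-! The kernels below are functions of `m = xᵀμ`, `m' = yᵀμ` and `t = xᵀy`. -/

/-- First kernel, `d = 1`, order `k`. -/
def phiCircle (k : ℕ) (ρ m : ℝ) : ℝ :=
  ρ / (2 * Real.pi ^ 2 * (k : ℝ) ^ 2) * (cheb k m - ρ / 4 * (2 - cheb (2 * k) m))

/-- Second kernel, `d = 1`, order `k`. At `t = -1` the factor `π - arccos t` vanishes,
so the term with the quotient is `0`, its limit. -/
def psiCircle (k : ℕ) (ρ m m' t : ℝ) : ℝ :=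
  psiCvM₁ (Real.arccos t)
    - ρ * ((Real.pi - Real.arccos t) / (2 * Real.pi ^ 2 * k)
        * cheb k ((m + m') / Real.sqrt (2 * (1 + t))) * Real.sin (k * Real.arccos t / 2))

/-- First kernel, `d = 2`, `k = 1`. -/
def phiSphere₁ (ρ m : ℝ) : ℝ :=
  ρ / 30 * m - ρ ^ 2 / 4 * (2 / 35 - 4 * m ^ 2 / 105)

/-- Second kernel, `d = 2`, `k = 1`. -/
def psiSphere₁ (ρ m m' t : ℝ) : ℝ :=
  psiCvM₂ (Real.arccos t) - ρ / 32 * Real.sqrt ((1 - t) / 2) * (m + m')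

/-- First kernel, `d = 2`, `k = 2`. -/
def phiSphere₂ (ρ m : ℝ) : ℝ :=
  ρ / 420 * (3 * m ^ 2 - 1) - ρ ^ 2 / 4 * (1 / 330 + 3 * m ^ 2 / 385 - m ^ 4 / 110)

/-- Second kernel, `d = 2`, `k = 2`. At `t = 1` the square root vanishes,
so the term with the quotients is `0`, its limit. -/
def psiSphere₂ (ρ m m' t : ℝ) : ℝ :=
  psiCvM₂ (Real.arccos t)
    + ρ / 128 * Real.sqrt ((1 - t) / 2)
        * ((1 + t) / 2 + 3 * (3 * t - 1) / (4 * (1 - t)) * (m ^ 2 + m' ^ 2)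
            + 3 * (t - 3) / (2 * (1 - t)) * (m * m'))

end SphCardioid

end

/-! ### The Cramér–von Mises statistic of an atomless law on the line. -/

section CramerVonMises

variable {ν : Measure ℝ} [IsProbabilityMeasure ν]

/-! For a fixed direction γ the inner integral is the classical Cramér–von Mises statistic of the
numbers a_i = γᵀX_i against an atomless law F. Since 1{a_i ≤ x} 1{a_j ≤ x} = 1{max(a_i, a_j) ≤ x},
expanding the square leaves only F(a_i), F(a_i)² and F(max(a_i, a_j)) (`cramerVonMises_eq`).
Averaging over uniform γ therefore reduces everything to three integrals
(`cvmUnifStat_eq_of_kernels`): the mean of F_γ(γᵀx) is 1/2, that of its square is 1/3 - φ(x), and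
that of F_γ(max(γᵀx, γᵀy)) is 1 - ψ(x, y). The constant (3 - 2n)/6 is what remains of the terms 1/3,
1/2 and 1.

To make F_γ explicit, the surface measure is written in angular coordinates (`surface_one_eq_map`,
`surface_two_eq_map`). Averaging the density over the points at a given angle from γ separates the
variables: the degree-k polynomial in xᵀμ becomes its value at γᵀμ times its value at γᵀx. So F_γ is
the uniform distribution function plus ρ times the polynomial at γᵀμ times an elementary function of
t (`projCdf_one_eq`, `projCdf_two_one_eq`, `projCdf_two_two_eq`).

The mean and the second moment are computed in coordinates centred at x. For the maximum, the
coordinates follow the symmetry exchanging x and y. On the circle, angles are measured from the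
bisector, and the maximum is the cosine of |α - β|. On the 2-sphere the pole is the direction of x -
y; there F_γ(max) is the average of the two values plus |γᵀx - γᵀy| times a polynomial, and |γᵀx -
γᵀy| is a constant multiple of |cos θ|. Hence only trigonometric integrals and integrals of |z|
times even polynomials remain. -/

lemma integrable_of_abs_le {α : Type*} [MeasurableSpace α] {m : Measure α} [IsFiniteMeasure m]
    {f : α → ℝ} (hf : Measurable f) {C : ℝ} (h : ∀ x, |f x| ≤ C) : Integrable f m :=
  Integrable.of_bound hf.aestronglyMeasurable C (ae_of_all _ h)

lemma measurable_cdf' (ν : Measure ℝ) : Measurable fun x => cdf ν x := (monotone_cdf ν).measurable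

lemma abs_cdf_le_one (ν : Measure ℝ) (x : ℝ) : |cdf ν x| ≤ 1 :=
  abs_le.2 ⟨by linarith [cdf_nonneg ν x], cdf_le_one ν x⟩

lemma integrable_cdf : Integrable (fun x => cdf ν x) ν :=
  integrable_of_abs_le (measurable_cdf' ν) (abs_cdf_le_one ν)

/-- Integral of a bounded function against `cdf ν`, by Fubini. -/
lemma integral_mul_cdf_eq {g : ℝ → ℝ} (hg : Measurable g) {C : ℝ} (hC : ∀ x, |g x| ≤ C) :
    ∫ x, g x * cdf ν x ∂ν = ∫ y, (∫ x in Ici y, g x ∂ν) ∂ν := by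
  have h1 : ∀ x, g x * cdf ν x = ∫ y, (Iic x).indicator (fun _ => g x) y ∂ν := fun x => by
    rw [integral_indicator measurableSet_Iic, setIntegral_const, cdf_eq_real, smul_eq_mul, mul_comm]
  have h2 : ∀ y, ∫ x in Ici y, g x ∂ν = ∫ x, (Iic x).indicator (fun _ => g x) y ∂ν := fun y => by
    rw [← integral_indicator measurableSet_Ici]
    refine integral_congr_ae (ae_of_all _ fun x => ?_)
    simp [indicator_apply]
  simp_rw [h1, h2]
  refine integral_integral_swap (f := fun x y => (Iic x).indicator (fun _ => g x) y) ?_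
  have hm : MeasurableSet {p : ℝ × ℝ | p.2 ≤ p.1} := measurableSet_le measurable_snd measurable_fst
  have : (Function.uncurry fun x y => (Iic x).indicator (fun _ => g x) y)
      = {p : ℝ × ℝ | p.2 ≤ p.1}.indicator fun p => g p.1 := by
    ext ⟨x, y⟩
    simp [indicator_apply]
  rw [this]
  exact (integrable_of_abs_le (hg.comp measurable_fst) fun p => hC p.1).indicator hm

variable [NullSingletonClass ν]

/-- This is where the absence of atoms enters: open and closed half-lines have the same mass. -/
lemma measureReal_Ici_eq_one_sub_cdf (a : ℝ) : ν.real (Ici a) = 1 - cdf ν a := by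
  rw [cdf_eq_real, ← measureReal_congr (Iio_ae_eq_Iic (μ := ν) (a := a)), ← compl_Ici,
    probReal_compl_eq_one_sub measurableSet_Ici]
  ring

/-- Fubini with the indicator of `Ici a` turns the integral into that of 1 - F(max(a, y)), in which
the unknown integral reappears with the opposite sign; solving the linear equation gives the value.
`integral_cdf_sq` follows by the same device, so no probability integral transform is needed. -/
lemma setIntegral_Ici_cdf (a : ℝ) : ∫ x in Ici a, cdf ν x ∂ν = (1 - cdf ν a ^ 2) / 2 := by
  have h := integral_mul_cdf_eq (ν := ν) (g := (Ici a).indicator fun _ => (1 : ℝ))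
    (measurable_const.indicator measurableSet_Ici) (C := 1) fun x => by
      by_cases hx : x ∈ Ici a <;> simp [hx]
  have e1 : ∀ x, (Ici a).indicator (fun _ => (1 : ℝ)) x * cdf ν x
      = (Ici a).indicator (fun x => cdf ν x) x := fun x => by
    by_cases hx : x ∈ Ici a <;> simp [hx]
  have e2 : ∀ y, ∫ x in Ici y, (Ici a).indicator (fun _ => (1 : ℝ)) x ∂ν
      = 1 - (cdf ν a + (Ici a).indicator (fun y => cdf ν y - cdf ν a) y) := fun y => by
    rw [integral_indicator measurableSet_Ici, Measure.restrict_restrict measurableSet_Ici,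
      setIntegral_const, Ici_inter_Ici, measureReal_Ici_eq_one_sub_cdf, smul_eq_mul, mul_one]
    by_cases hy : a ≤ y
    · simp [hy]
    · simp [hy, (not_le.1 hy).le]
  have i1 : Integrable (fun x => cdf ν x - cdf ν a) ν := integrable_cdf.sub (integrable_const _)
  have i2 : Integrable (fun y => cdf ν a + (Ici a).indicator (fun y => cdf ν y - cdf ν a) y) ν :=
    (integrable_const _).add (i1.indicator measurableSet_Ici)
  simp_rw [e1, e2] at h
  rw [integral_indicator measurableSet_Ici, integral_sub (integrable_const _) i2, integral_add (integrable_const _)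
    (i1.indicator measurableSet_Ici), integral_indicator measurableSet_Ici,
    integral_sub integrable_cdf.integrableOn (integrable_const _)] at h
  simp only [integral_const, probReal_univ, measureReal_Ici_eq_one_sub_cdf, smul_eq_mul,
    measureReal_restrict_apply_univ] at h
  linarith

lemma integral_cdf_sq : ∫ x, cdf ν x ^ 2 ∂ν = 1 / 3 := by
  have i2 : Integrable (fun x => cdf ν x ^ 2) ν :=
    integrable_of_abs_le ((measurable_cdf' ν).pow_const 2) (C := 1) fun x => by
      rw [abs_pow]; exact pow_le_one₀ (abs_nonneg _) (abs_cdf_le_one ν x)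
  have h := integral_mul_cdf_eq (ν := ν) (measurable_cdf' ν) (abs_cdf_le_one ν)
  simp_rw [setIntegral_Ici_cdf, ← sq] at h
  rw [integral_div, integral_sub (integrable_const _) i2] at h
  simp only [integral_const, probReal_univ, smul_eq_mul] at h
  linarith

/-- Sum of a symmetric function over pairs. -/
lemma sum_sum_eq_diag_add_Ioi {n : ℕ} (f : Fin n → Fin n → ℝ) (hf : ∀ i j, f i j = f j i) :
    ∑ i, ∑ j, f i j = ∑ i, f i i + 2 * ∑ i, ∑ j ∈ Finset.Ioi i, f i j := by
  have h1 : ∀ i, ∑ j, f i j = f i i + ∑ j ∈ Finset.Ioi i, f i j + ∑ j ∈ Finset.Iio i, f i j := by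
    intro i
    have : (Finset.univ : Finset (Fin n)) = insert i (Finset.Ioi i ∪ Finset.Iio i) := by
      ext j
      have := lt_trichotomy i j
      simp only [Finset.mem_univ, Finset.mem_insert, Finset.mem_union, Finset.mem_Ioi,
        Finset.mem_Iio, true_iff]
      tauto
    rw [this, Finset.sum_insert (by simp), Finset.sum_union, add_assoc]
    exact Finset.disjoint_left.2 fun j h h' => by simp at h h'; exact lt_asymm h h'
  have h2 : ∑ i, ∑ j ∈ Finset.Iio i, f i j = ∑ i, ∑ j ∈ Finset.Ioi i, f i j := by
    rw [Finset.sum_comm' (t' := Finset.univ) (s' := fun j => Finset.Ioi j) (by simp)]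
    exact Finset.sum_congr rfl fun i _ => Finset.sum_congr rfl fun j _ => hf j i
  simp_rw [h1, Finset.sum_add_distrib, h2]
  ring

/-- The Cramér–von Mises statistic of a continuous distribution in closed form. -/
theorem cramerVonMises_eq {n : ℕ} (hn : 1 ≤ n) (a : Fin n → ℝ) :
    n * ∫ x, (1 / (n : ℝ) * ∑ i, (Iic x).indicator (fun _ => (1 : ℝ)) (a i) - cdf ν x) ^ 2 ∂ν
      = n / 3 + ∑ i, cdf ν (a i) ^ 2 - 1 / n * ∑ i, cdf ν (a i)
        - 2 / n * ∑ i, ∑ j ∈ Finset.Ioi i, cdf ν (max (a i) (a j)) := by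
  have hn' : (n : ℝ) ≠ 0 := by positivity
  -- Seen as a function of x, the indicator of a_i ≤ x lives on `Ici (a i)`, and intersecting two
  -- such half-lines produces the maximum.
  have e : ∀ x, (1 / (n : ℝ) * ∑ i, (Iic x).indicator (fun _ => (1 : ℝ)) (a i) - cdf ν x) ^ 2
      = (1 / n ^ 2 * ∑ i, ∑ j, (Ici (max (a i) (a j))).indicator (fun _ => (1 : ℝ)) x
        - 2 / n * ∑ i, (Ici (a i)).indicator (fun x => cdf ν x) x) + cdf ν x ^ 2 := fun x => by
    have h1 : ∀ i, (Iic x).indicator (fun _ => (1 : ℝ)) (a i)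
        = (Ici (a i)).indicator (fun _ => (1 : ℝ)) x := fun i => by simp [indicator_apply]
    have h2 : ∀ i j, (Ici (max (a i) (a j))).indicator (fun _ => (1 : ℝ)) x
        = (Ici (a i)).indicator (fun _ => (1 : ℝ)) x * (Ici (a j)).indicator (fun _ => (1 : ℝ)) x :=
      fun i j => by
        rw [← Ici_inter_Ici]
        simp only [indicator_apply, mem_inter_iff]
        split_ifs <;> simp_all
    have h3 : ∀ i, (Ici (a i)).indicator (fun x => cdf ν x) x
        = (Ici (a i)).indicator (fun _ => (1 : ℝ)) x * cdf ν x := fun i => by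
      simp [indicator_apply]
    simp_rw [h1, h2, h3, ← Finset.mul_sum, ← Finset.sum_mul]
    field_simp
    ring
  have i1 : ∀ b, Integrable ((Ici b).indicator fun _ => (1 : ℝ)) ν := fun b =>
    (integrable_const _).indicator measurableSet_Ici
  have i2 : ∀ b, Integrable ((Ici b).indicator fun x => cdf ν x) ν := fun b =>
    integrable_cdf.indicator measurableSet_Ici
  have i3 : Integrable (fun x => cdf ν x ^ 2) ν :=
    integrable_of_abs_le ((measurable_cdf' ν).pow_const 2) (C := 1) fun x => by
      rw [abs_pow]; exact pow_le_one₀ (abs_nonneg _) (abs_cdf_le_one ν x)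
  have i4 : Integrable (fun x => 1 / (n : ℝ) ^ 2 *
      ∑ i, ∑ j, (Ici (max (a i) (a j))).indicator (fun _ => (1 : ℝ)) x) ν :=
    (integrable_finsetSum _ fun i _ => integrable_finsetSum _ fun j _ => i1 _).const_mul _
  have i5 : Integrable (fun x => 2 / (n : ℝ) * ∑ i, (Ici (a i)).indicator (fun x => cdf ν x) x) ν :=
    (integrable_finsetSum _ fun i _ => i2 _).const_mul _
  have i6 := i4.sub i5
  simp only [Pi.sub_def] at i6
  simp_rw [e]
  rw [integral_add i6 i3, integral_sub i4 i5, integral_const_mul, integral_const_mul,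
    integral_finsetSum _ fun i _ => integrable_finsetSum _ fun j _ => i1 _,
    integral_finsetSum _ fun i _ => i2 _, integral_cdf_sq]
  have e1 : ∀ i, ∫ x, ∑ j, (Ici (max (a i) (a j))).indicator (fun _ => (1 : ℝ)) x ∂ν
      = ∑ j, (1 - cdf ν (max (a i) (a j))) := fun i => by
    rw [integral_finsetSum _ fun j _ => i1 _]
    refine Finset.sum_congr rfl fun j _ => ?_
    rw [integral_indicator measurableSet_Ici, setIntegral_const, measureReal_Ici_eq_one_sub_cdf,
      smul_eq_mul, mul_one]
  have e2 : ∀ i, ∫ x, (Ici (a i)).indicator (fun x => cdf ν x) x ∂ν = (1 - cdf ν (a i) ^ 2) / 2 :=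
    fun i => by rw [integral_indicator measurableSet_Ici, setIntegral_Ici_cdf]
  simp_rw [e1, e2, Finset.sum_sub_distrib]
  rw [sum_sum_eq_diag_add_Ioi (fun i j => cdf ν (max (a i) (a j))) fun i j => by rw [max_comm]]
  simp_rw [max_self, ← Finset.sum_div, Finset.sum_sub_distrib]
  simp only [Finset.sum_const, Finset.card_univ, Fintype.card_fin, nsmul_eq_mul]
  field_simp
  ring

end CramerVonMises

noncomputable section

namespace SphCardioid

open scoped Pointwise Real ENNReal

/-! ### Surface measure through the volume of cones. -/

section Cone

variable {d : ℕ}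

/-- The open cone of height one over a subset of the sphere. -/
def cone (s : Set (Sph d)) : Set (EuclideanSpace ℝ (Fin (d + 1))) :=
  Ioo (0 : ℝ) 1 • ((↑) '' s)

lemma surface_apply {s : Set (Sph d)} (hs : MeasurableSet s) :
    surface d s = (d + 1 : ℕ) * volume (cone s) := by
  rw [surface, Measure.toSphere_apply' _ hs, finrank_euclideanSpace_fin, cone]

/-- Taking norms recovers the radius. Consequently the indicator of a cone factors into a radial and
an angular part in polar coordinates. -/
lemma smul_mem_cone_iff {s : Set (Sph d)} {r : ℝ} (hr : 0 < r) (u : Sph d) :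
    r • (u : EuclideanSpace ℝ (Fin (d + 1))) ∈ cone s ↔ r < 1 ∧ u ∈ s := by
  constructor
  · rintro ⟨r', hr', _, ⟨v, hv, rfl⟩, h⟩
    dsimp only at h
    have hn := congrArg norm h
    rw [norm_smul, norm_smul, norm_eq_of_mem_sphere, norm_eq_of_mem_sphere, mul_one, mul_one,
      Real.norm_of_nonneg hr.le, Real.norm_of_nonneg hr'.1.le] at hn
    subst hn
    have : v = u := Subtype.ext (smul_right_injective _ hr.ne' h)
    exact ⟨hr'.2, this ▸ hv⟩
  · rintro ⟨h1, hu⟩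
    exact ⟨r, ⟨hr, h1⟩, u, ⟨u, hu, rfl⟩, rfl⟩

/-- The cone is the image of s × (0, 1) under the polar homeomorphism onto the punctured space,
which is a measurable embedding. -/
lemma measurableSet_cone {s : Set (Sph d)} (hs : MeasurableSet s) : MeasurableSet (cone s) := by
  have he : MeasurableEmbedding (Subtype.val ∘
      (homeomorphUnitSphereProd (EuclideanSpace ℝ (Fin (d + 1)))).symm) :=
    (MeasurableEmbedding.subtype_coe (measurableSet_singleton _).compl).comp
      (Homeomorph.measurableEmbedding _)
  have : cone s = (Subtype.val ∘
      (homeomorphUnitSphereProd (EuclideanSpace ℝ (Fin (d + 1)))).symm) ''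
        (s ×ˢ {r : Ioi (0 : ℝ) | (r : ℝ) < 1}) := by
    ext x
    constructor
    · rintro ⟨r, hr, _, ⟨v, hv, rfl⟩, rfl⟩
      exact ⟨(v, ⟨r, hr.1⟩), ⟨hv, hr.2⟩, by simp⟩
    · rintro ⟨⟨v, r⟩, ⟨hv, hr⟩, rfl⟩
      exact ⟨r, ⟨r.2, hr⟩, v, ⟨v, hv, rfl⟩, by simp⟩
  rw [this, he.measurableSet_image]
  exact hs.prod (measurableSet_lt measurable_subtype_coe measurable_const)

lemma lintegral_radial (n : ℕ) :
    ∫⁻ r in Ioi (0 : ℝ), (Iio 1).indicator (fun r => ENNReal.ofReal (r ^ n)) r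
      = ENNReal.ofReal (1 / (n + 1)) := by
  rw [lintegral_indicator measurableSet_Iio, Measure.restrict_restrict measurableSet_Iio,
    Iio_inter_Ioi, Measure.restrict_congr_set Ioo_ae_eq_Ioc,
    ← ofReal_integral_eq_lintegral_ofReal (intervalIntegral.intervalIntegrable_pow _).1,
    ← intervalIntegral.integral_of_le zero_le_one]
  · simp
  · filter_upwards [ae_restrict_mem measurableSet_Ioc] with y hy
    exact pow_nonneg hy.1.le _

lemma natCast_mul_ofReal_inv (n : ℕ) :
    ((n + 1 : ℕ) : ℝ≥0∞) * ENNReal.ofReal (1 / (n + 1)) = 1 := by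
  rw [← ENNReal.ofReal_natCast, ← ENNReal.ofReal_mul (by positivity)]
  push_cast
  rw [mul_one_div_cancel (by positivity), ENNReal.ofReal_one]

end Cone

/-! ### Angular coordinate on the circle. -/

section Circle

/-- The point of the circle with polar angle `α`. -/
def circlePt (α : ℝ) : Sph 1 :=
  ⟨!₂[Real.cos α, Real.sin α], by
    simp [EuclideanSpace.norm_eq]⟩

lemma dot_circlePt (α β : ℝ) : dot (circlePt α) (circlePt β) = Real.cos (α - β) := by
  simp [dot, circlePt, Real.cos_sub, PiLp.inner_apply, Fin.sum_univ_two]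
  ring

lemma continuous_circlePt : Continuous circlePt := by
  refine Continuous.subtype_mk ?_ _
  refine (PiLp.continuous_toLp 2 _).comp (continuous_pi fun i => ?_)
  fin_cases i <;> simp <;> fun_prop

lemma exists_circlePt_eq (x : Sph 1) : ∃ α, circlePt α = x := by
  obtain ⟨x, hx⟩ := x
  have h : x 0 ^ 2 + x 1 ^ 2 = 1 := by
    simpa [EuclideanSpace.norm_eq, Fin.sum_univ_two] using hx
  refine ⟨Complex.arg ⟨x 0, x 1⟩, Subtype.ext ?_⟩
  have hn : ‖(⟨x 0, x 1⟩ : ℂ)‖ = 1 := by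
    rw [Complex.norm_def, Complex.normSq_mk, ← sq, ← sq, h, Real.sqrt_one]
  have hz : (⟨x 0, x 1⟩ : ℂ) ≠ 0 := by
    rw [← norm_ne_zero_iff, hn]; exact one_ne_zero
  ext i
  fin_cases i <;> simp [circlePt, Complex.cos_arg hz, Complex.sin_arg, hn]

lemma measurePreserving_euclideanTwo :
    MeasurePreserving (fun p : ℝ × ℝ => (!₂[p.1, p.2] : EuclideanSpace ℝ (Fin 2))) :=
  (PiLp.volume_preserving_toLp (Fin 2)).comp
    ((volume_preserving_finTwoArrow ℝ).symm _)

/-- In polar coordinates the area of the cone is the integral of r over (0, 1) times the length of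
the set of angles; the factor 1/2 cancels the dimension factor 2 of `surface_apply`. -/
theorem surface_one_eq_map :
    surface 1 = (volume.restrict (Ioo (-π) π)).map circlePt := by
  classical
  ext s hs
  have hc := measurableSet_cone hs
  rw [Measure.map_apply continuous_circlePt.measurable hs, surface_apply hs,
    ← measurePreserving_euclideanTwo.measure_preimage hc.nullMeasurableSet,
    ← lintegral_indicator_one (measurePreserving_euclideanTwo.measurable hc),
    ← lintegral_comp_polarCoord_symm]
  have e : ∀ p ∈ polarCoord.target, ENNReal.ofReal p.1 •
      ((fun p : ℝ × ℝ => (!₂[p.1, p.2] : EuclideanSpace ℝ (Fin 2))) ⁻¹' cone s).indicator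
        (1 : ℝ × ℝ → ℝ≥0∞) (polarCoord.symm p)
      = (Iio (1 : ℝ)).indicator (fun r => ENNReal.ofReal (r ^ 1)) p.1
        * (circlePt ⁻¹' s).indicator 1 p.2 := by
    rintro ⟨r, θ⟩ ⟨hr, -⟩
    have h1 : (!₂[r * Real.cos θ, r * Real.sin θ] : EuclideanSpace ℝ (Fin 2))
        = r • (circlePt θ : EuclideanSpace ℝ (Fin 2)) := by
      ext i; fin_cases i <;> simp [circlePt]
    have h2 := smul_mem_cone_iff (s := s) hr (circlePt θ)
    rw [← h1] at h2
    simp only [polarCoord_symm_apply, indicator_apply, mem_preimage, h2, mem_Iio, pow_one,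
      Pi.one_apply, smul_eq_mul]
    split_ifs <;> simp_all
  rw [setLIntegral_congr_fun polarCoord.open_target.measurableSet e, polarCoord_target,
    Measure.volume_eq_prod, ← Measure.prod_restrict,
    lintegral_prod_mul (f := fun r => (Iio (1 : ℝ)).indicator (fun r => ENNReal.ofReal (r ^ 1)) r)
      (g := fun θ => (circlePt ⁻¹' s).indicator 1 θ), lintegral_radial, ← mul_assoc,
    natCast_mul_ofReal_inv, one_mul,
    lintegral_indicator_one (continuous_circlePt.measurable hs)]
  · exact ((by fun_prop : Measurable fun r : ℝ => ENNReal.ofReal (r ^ 1)).indicator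
      measurableSet_Iio).aemeasurable
  · exact (measurable_one.indicator (continuous_circlePt.measurable hs)).aemeasurable

end Circle

/-! ### Spherical coordinates in an arbitrary orthonormal frame. -/

section Sphere

variable (b : OrthonormalBasis (Fin 3) ℝ (EuclideanSpace ℝ (Fin 3)))

/-- The point of the sphere with polar angle `θ` and azimuth `φ` in the frame `b`. -/
def spherePt (θ φ : ℝ) : Sph 2 :=
  ⟨b.repr.symm !₂[Real.cos θ, Real.sin θ * Real.cos φ, Real.sin θ * Real.sin φ], by
    rw [mem_sphere_zero_iff_norm, LinearIsometryEquiv.norm_map, EuclideanSpace.norm_eq]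
    simp only [Fin.sum_univ_three, Real.norm_eq_abs, sq_abs, Real.sqrt_eq_one]
    simp
    linear_combination (Real.sin θ) ^ 2 * Real.sin_sq_add_cos_sq φ + Real.sin_sq_add_cos_sq θ⟩

lemma inner_spherePt (θ φ : ℝ) (v : EuclideanSpace ℝ (Fin 3)) :
    inner ℝ (spherePt b θ φ : EuclideanSpace ℝ (Fin 3)) v
      = Real.cos θ * inner ℝ (b 0) v + Real.sin θ * Real.cos φ * inner ℝ (b 1) v
        + Real.sin θ * Real.sin φ * inner ℝ (b 2) v := by
  rw [← b.repr.inner_map_map]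
  simp [spherePt, PiLp.inner_apply, Fin.sum_univ_three, OrthonormalBasis.repr_apply_apply]
  ring

lemma continuous_spherePt : Continuous fun p : ℝ × ℝ => spherePt b p.1 p.2 := by
  refine Continuous.subtype_mk ?_ _
  refine b.repr.symm.continuous.comp
    ((PiLp.continuous_toLp 2 _).comp (continuous_pi fun i => ?_))
  fin_cases i <;> simp <;> fun_prop

lemma measurePreserving_euclideanThree :
    MeasurePreserving (fun p : ℝ × ℝ × ℝ =>
      b.repr.symm (!₂[p.1, p.2.1, p.2.2] : EuclideanSpace ℝ (Fin 3))) := by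
  have h := (b.measurePreserving_repr_symm).comp ((PiLp.volume_preserving_toLp (Fin 3)).comp
    (((volume_preserving_piFinSuccAbove (fun _ : Fin 3 => ℝ) 0).symm _).comp
      ((MeasurePreserving.id volume).prod ((volume_preserving_finTwoArrow ℝ).symm _))))
  refine (congrArg (MeasurePreserving · volume volume) ?_).mpr h
  funext p
  refine congrArg b.repr.symm ?_
  ext i
  fin_cases i <;> rfl

/-- The law of the spherical coordinates under the surface measure. -/
def sphericalMeasure : Measure (ℝ × ℝ) :=
  ((volume.restrict (Ioo 0 π)).withDensity fun θ => ENNReal.ofReal (Real.sin θ)).prod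
    (volume.restrict (Ioo (-π) π))

/-- Two planar polar changes give spherical coordinates: first in the plane orthogonal to `b 0`,
with radius s and azimuth φ, then in the half-plane of (z, s), with radius r and polar angle θ. The
Jacobian is s · r = r² sin θ. The frame stays free so that later integrals can choose their pole. -/
theorem surface_two_eq_map :
    surface 2 = sphericalMeasure.map fun p => spherePt b p.1 p.2 := by
  classical
  ext s hs
  have hc := measurableSet_cone hs
  have hP := measurePreserving_euclideanThree b
  set f : ℝ × ℝ × ℝ → ℝ≥0∞ := ((fun p : ℝ × ℝ × ℝ =>
      b.repr.symm (!₂[p.1, p.2.1, p.2.2] : EuclideanSpace ℝ (Fin 3))) ⁻¹' cone s).indicator 1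
    with hf
  have hfm : Measurable f := measurable_one.indicator (hP.measurable hc)
  have hsm : MeasurableSet ((fun p : ℝ × ℝ => spherePt b p.1 p.2) ⁻¹' s) :=
    (continuous_spherePt b).measurable hs
  have hpt : ∀ {r : ℝ}, 0 < r → ∀ θ φ, f (r * Real.cos θ, (r * Real.sin θ) * Real.cos φ,
      (r * Real.sin θ) * Real.sin φ) = (Iio (1 : ℝ)).indicator 1 r
        * ((fun p : ℝ × ℝ => spherePt b p.1 p.2) ⁻¹' s).indicator 1 (θ, φ) := by
    intro r hr θ φ
    have h2 := smul_mem_cone_iff (s := s) hr (spherePt b θ φ)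
    have h1 : b.repr.symm (!₂[r * Real.cos θ, (r * Real.sin θ) * Real.cos φ,
        (r * Real.sin θ) * Real.sin φ] : EuclideanSpace ℝ (Fin 3))
        = r • (spherePt b θ φ : EuclideanSpace ℝ (Fin 3)) := by
      rw [spherePt, ← map_smul]
      congr 1
      ext i; fin_cases i <;> simp [mul_assoc]
    rw [← h1] at h2
    simp only [hf, indicator_apply, mem_preimage, h2, mem_Iio, Pi.one_apply]
    split_ifs <;> simp_all
  have key : ∀ φ, ∫⁻ z, ∫⁻ s in Ioi (0 : ℝ),
      ENNReal.ofReal s * f (z, s * Real.cos φ, s * Real.sin φ)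
      = ENNReal.ofReal (1 / 3) * ∫⁻ θ in Ioo 0 π, ENNReal.ofReal (Real.sin θ)
        * ((fun p : ℝ × ℝ => spherePt b p.1 p.2) ⁻¹' s).indicator 1 (θ, φ) := by
    intro φ
    -- `ENNReal.ofReal s` vanishes for s ≤ 0, so the half-plane extends to the whole plane, where
    -- polar coordinates apply.
    have e1 : ∀ z, ∫⁻ s in Ioi (0 : ℝ), ENNReal.ofReal s * f (z, s * Real.cos φ, s * Real.sin φ)
        = ∫⁻ s, ENNReal.ofReal s * f (z, s * Real.cos φ, s * Real.sin φ) := fun z => by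
      refine setLIntegral_eq_of_support_subset ?_
      intro s hs
      by_contra h
      exact hs (by simp [ENNReal.ofReal_of_nonpos (not_lt.1 h)])
    have e2 : ∀ p ∈ polarCoord.target, ENNReal.ofReal p.1 • (fun q : ℝ × ℝ =>
        ENNReal.ofReal q.2 * f (q.1, q.2 * Real.cos φ, q.2 * Real.sin φ)) (polarCoord.symm p)
        = (Iio (1 : ℝ)).indicator (fun r => ENNReal.ofReal (r ^ 2)) p.1
          * (ENNReal.ofReal (Real.sin p.2)
            * ((fun p : ℝ × ℝ => spherePt b p.1 p.2) ⁻¹' s).indicator 1 (p.2, φ)) := by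
      rintro ⟨r, θ⟩ ⟨hr, -⟩
      simp only [mem_Ioi] at hr
      simp only [polarCoord_symm_apply, hpt hr, ENNReal.ofReal_mul hr.le, smul_eq_mul]
      by_cases h : r < 1
      · simp [h, ENNReal.ofReal_pow hr.le]; ring
      · simp [h]
    have hm : Measurable fun θ => ENNReal.ofReal (Real.sin θ)
        * ((fun p : ℝ × ℝ => spherePt b p.1 p.2) ⁻¹' s).indicator (1 : ℝ × ℝ → ℝ≥0∞) (θ, φ) :=
      (Real.measurable_sin.ennreal_ofReal).mul
        ((measurable_one.indicator hsm).comp (by fun_prop : Measurable fun θ : ℝ => (θ, φ)))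
    simp_rw [e1]
    rw [← lintegral_prod (f := fun q : ℝ × ℝ =>
        ENNReal.ofReal q.2 * f (q.1, q.2 * Real.cos φ, q.2 * Real.sin φ)),
      ← Measure.volume_eq_prod, ← lintegral_comp_polarCoord_symm,
      setLIntegral_congr_fun polarCoord.open_target.measurableSet e2, polarCoord_target,
      Measure.volume_eq_prod, ← Measure.prod_restrict,
      lintegral_prod_mul
        (f := fun r => (Iio (1 : ℝ)).indicator (fun r => ENNReal.ofReal (r ^ 2)) r)
        (g := fun θ => ENNReal.ofReal (Real.sin θ)
            * ((fun p : ℝ × ℝ => spherePt b p.1 p.2) ⁻¹' s).indicator 1 (θ, φ)),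
      lintegral_radial]
    · congr 1
      · norm_num
      · rw [← lintegral_indicator measurableSet_Ioo, ← lintegral_indicator measurableSet_Ioo]
        refine lintegral_congr fun θ => ?_
        -- The planar angle runs over (-π, π), but the truncated sine kills its nonpositive part.
        by_cases h0 : θ ∈ Ioo 0 π
        · have h1 : θ ∈ Ioo (-π) π := ⟨by linarith [h0.1, Real.pi_pos], h0.2⟩
          rw [indicator_of_mem h0, indicator_of_mem h1]
        · rw [indicator_of_notMem h0]
          by_cases h1 : θ ∈ Ioo (-π) π
          · have h2 : θ ≤ 0 := not_lt.1 fun h => h0 ⟨h, h1.2⟩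
            rw [indicator_of_mem h1, ENNReal.ofReal_of_nonpos
              (Real.sin_nonpos_of_nonpos_of_neg_pi_le h2 h1.1.le), zero_mul]
          · rw [indicator_of_notMem h1]
    · exact ((by fun_prop : Measurable fun r : ℝ => ENNReal.ofReal (r ^ 2)).indicator
        measurableSet_Iio).aemeasurable
    · exact hm.aemeasurable
    · exact ((measurable_snd.ennreal_ofReal).mul (hfm.comp (by fun_prop))).aemeasurable
  have hslice : ∀ z, ∫⁻ y : ℝ × ℝ, f (z, y) = ∫⁻ φ in Ioo (-π) π, ∫⁻ s in Ioi (0 : ℝ),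
      ENNReal.ofReal s * f (z, s * Real.cos φ, s * Real.sin φ) := by
    intro z
    rw [← lintegral_comp_polarCoord_symm, polarCoord_target, Measure.volume_eq_prod,
      ← Measure.prod_restrict, lintegral_prod_symm']
    · simp [polarCoord_symm_apply]
    · exact (measurable_fst.ennreal_ofReal).mul
        (hfm.comp (measurable_const.prodMk continuous_polarCoord_symm.measurable))
  have hswap : ∫⁻ z, ∫⁻ φ in Ioo (-π) π, ∫⁻ s in Ioi (0 : ℝ),
      ENNReal.ofReal s * f (z, s * Real.cos φ, s * Real.sin φ)
      = ∫⁻ φ in Ioo (-π) π, ∫⁻ z, ∫⁻ s in Ioi (0 : ℝ),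
      ENNReal.ofReal s * f (z, s * Real.cos φ, s * Real.sin φ) := by
    refine lintegral_lintegral_swap (Measurable.aemeasurable ?_)
    refine Measurable.lintegral_prod_right' (f := fun q : (ℝ × ℝ) × ℝ =>
      ENNReal.ofReal q.2 * f (q.1.1, q.2 * Real.cos q.1.2, q.2 * Real.sin q.1.2)) ?_
    exact (measurable_snd.ennreal_ofReal).mul (hfm.comp (by fun_prop))
  rw [Measure.map_apply (continuous_spherePt b).measurable hs, surface_apply hs,
    ← hP.measure_preimage hc.nullMeasurableSet,
    ← lintegral_indicator_one (hP.measurable hc), ← hf, Measure.volume_eq_prod,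
    lintegral_prod _ hfm.aemeasurable]
  simp_rw [hslice]
  rw [hswap]
  simp_rw [key]
  have h3 := natCast_mul_ofReal_inv 2
  norm_num at h3
  rw [lintegral_const_mul' _ _ ENNReal.ofReal_ne_top, ← mul_assoc]
  norm_num [h3]
  rw [← lintegral_indicator_one hsm, sphericalMeasure,
    lintegral_prod_symm' _ (measurable_one.indicator hsm)]
  refine lintegral_congr fun φ => ?_
  exact (lintegral_withDensity_eq_lintegral_mul _ Real.measurable_sin.ennreal_ofReal
    ((measurable_one.indicator hsm).comp (by fun_prop : Measurable fun θ : ℝ => (θ, φ)))).symm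

end Sphere

/-! ### Reduction of the statistic to three averages over directions. -/

section General

variable {d k : ℕ}

instance : IsFiniteMeasure (surface d) := by unfold surface; infer_instance

lemma surface_univ_ne_zero : surface d univ ≠ 0 := by
  rw [Measure.measure_univ_ne_zero, surface]
  exact Measure.toSphere_ne_zero _

lemma area_pos : 0 < area d :=
  ENNReal.toReal_pos surface_univ_ne_zero (measure_ne_top _ _)

instance : IsProbabilityMeasure (unif d) :=
  ⟨by rw [unif, Measure.smul_apply, smul_eq_mul,
    ENNReal.inv_mul_cancel surface_univ_ne_zero (measure_ne_top _ _)]⟩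

lemma integral_unif (f : Sph d → ℝ) : ∫ γ, f γ ∂(unif d) = 1 / area d * ∫ γ, f γ ∂(surface d) := by
  rw [unif, integral_smul_measure, ENNReal.toReal_inv, smul_eq_mul, one_div, area,
    measureReal_def]

lemma continuous_dot_left (y : Sph d) : Continuous fun x => dot x y := by
  unfold dot; fun_prop

lemma dot_comm (x y : Sph d) : dot x y = dot y x := real_inner_comm _ _

lemma continuous_dot_right (x : Sph d) : Continuous fun y => dot x y := by
  unfold dot; fun_prop

lemma dot_self (x : Sph d) : dot x x = 1 := by
  rw [dot, real_inner_self_eq_norm_sq, norm_eq_of_mem_sphere, one_pow]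

lemma dot_mem_Icc (x y : Sph d) : dot x y ∈ Icc (-1 : ℝ) 1 := by
  have h := abs_real_inner_le_norm (x : EuclideanSpace ℝ (Fin (d + 1))) y
  rw [norm_eq_of_mem_sphere, norm_eq_of_mem_sphere, mul_one] at h
  exact abs_le.1 h

lemma integrable_of_continuous {m : Measure (Sph d)} [IsFiniteMeasure m] {f : Sph d → ℝ}
    (hf : Continuous f) : Integrable f m :=
  hf.integrable_of_hasCompactSupport (HasCompactSupport.of_compactSpace f)

variable {μ : Sph d} {ρ : ℝ}

lemma cardioid_apply_eq_ofReal (hC : Continuous (sphPolyNormalized d k))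
    (h0 : ∀ x, 0 ≤ 1 + ρ * sphPolyNormalized d k (dot x μ)) {s : Set (Sph d)}
    (hs : MeasurableSet s) :
    cardioid d k μ ρ s = ENNReal.ofReal
      (1 / area d * ∫ x in s, (1 + ρ * sphPolyNormalized d k (dot x μ)) ∂(surface d)) := by
  have hcont : Continuous fun x : Sph d =>
      1 / area d * (1 + ρ * sphPolyNormalized d k (dot x μ)) :=
    continuous_const.mul
      (continuous_const.add (continuous_const.mul (hC.comp (continuous_dot_left μ))))
  rw [cardioid, withDensity_apply _ hs, ← integral_const_mul, ofReal_integral_eq_lintegral_ofReal]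
  · exact (integrable_of_continuous hcont).integrableOn
  · exact ae_of_all _ fun x => mul_nonneg (one_div_nonneg.2 area_pos.le) (h0 x)

lemma isProbabilityMeasure_cardioid (hC : Continuous (sphPolyNormalized d k))
    (h0 : ∀ x, 0 ≤ 1 + ρ * sphPolyNormalized d k (dot x μ))
    (h1 : ∫ x, sphPolyNormalized d k (dot x μ) ∂(surface d) = 0) :
    IsProbabilityMeasure (cardioid d k μ ρ) := by
  have hCi : Continuous fun x => sphPolyNormalized d k (dot x μ) := hC.comp (continuous_dot_left μ)
  constructor
  rw [cardioid_apply_eq_ofReal hC h0 .univ, Measure.restrict_univ, integral_add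
    (integrable_const _) ((integrable_of_continuous hCi).const_mul _),
    integral_const_mul, h1, integral_const, mul_zero, add_zero, smul_eq_mul, mul_one,
    show (surface d).real univ = area d from rfl, one_div_mul_cancel area_pos.ne',
    ENNReal.ofReal_one]

/-- Nonnegativity of the density and the vanishing mean of the polynomial make the cardioid a
probability measure, for which `cdf` is the mass of a half-line. -/
lemma projCdf_eq_setIntegral (hC : Continuous (sphPolyNormalized d k))
    (h0 : ∀ x, 0 ≤ 1 + ρ * sphPolyNormalized d k (dot x μ))
    (h1 : ∫ x, sphPolyNormalized d k (dot x μ) ∂(surface d) = 0) (γ : Sph d) (t : ℝ) :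
    projCdf d k μ ρ γ t = 1 / area d *
      ∫ x in {x | dot γ x ≤ t}, (1 + ρ * sphPolyNormalized d k (dot x μ)) ∂(surface d) := by
  have := isProbabilityMeasure_cardioid hC h0 h1
  have hm := (continuous_dot_right γ).measurable
  have := Measure.isProbabilityMeasure_map (μ := cardioid d k μ ρ) hm.aemeasurable
  rw [projCdf, cdf_eq_real, measureReal_def, Measure.map_apply hm measurableSet_Iic,
    cardioid_apply_eq_ofReal hC h0 (hm measurableSet_Iic), ENNReal.toReal_ofReal]
  · rfl
  · exact mul_nonneg (one_div_nonneg.2 area_pos.le) (integral_nonneg h0)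

lemma stieltjesComp_cvmWeight (F : StieltjesFunction ℝ) : stieltjesComp cvmWeight F = F :=
  StieltjesFunction.ext fun _ => rfl

/-- Reduction of the projected Cramér–von Mises statistic to three integrals over the directions,
when the projected distribution functions are known. -/
theorem cvmUnifStat_eq_of_kernels {n : ℕ} (hn : 1 ≤ n) (X : Fin n → Sph d)
    (hC : Continuous (sphPolyNormalized d k))
    (h0 : ∀ x, 0 ≤ 1 + ρ * sphPolyNormalized d k (dot x μ))
    (h1 : ∫ x, sphPolyNormalized d k (dot x μ) ∂(surface d) = 0)
    (hnull : ∀ (γ : Sph d) (t : ℝ), surface d {x | dot γ x = t} = 0)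
    {F : Sph d → ℝ → ℝ} (hF : ∀ γ, ∀ t ∈ Icc (-1 : ℝ) 1, projCdf d k μ ρ γ t = F γ t)
    (hFc : Continuous fun p : Sph d × ℝ => F p.1 p.2)
    {φ : Sph d → ℝ} {ψ : Sph d → Sph d → ℝ}
    (e1 : ∀ x, ∫ γ, F γ (dot γ x) ∂(unif d) = 1 / 2)
    (e2 : ∀ x, ∫ γ, F γ (dot γ x) ^ 2 ∂(unif d) = 1 / 3 - φ x)
    (e3 : ∀ x y, ∫ γ, F γ (max (dot γ x) (dot γ y)) ∂(unif d) = 1 - ψ x y) :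
    cvmUnifStat k μ ρ X = (3 - 2 * (n : ℝ)) / 6 - ∑ i, φ (X i)
      + 2 / (n : ℝ) * ∑ i, ∑ j ∈ Finset.Ioi i, ψ (X i) (X j) := by
  have hn' : (n : ℝ) ≠ 0 := by positivity
  have hprob := isProbabilityMeasure_cardioid hC h0 h1
  have inner : ∀ γ : Sph d, n * ∫ x in Icc (-1 : ℝ) 1, (projEcdf X γ x - projCdf d k μ ρ γ x) ^ 2
      ∂(stieltjesComp cvmWeight (projCdf d k μ ρ γ)).measure
      = n / 3 + ∑ i, F γ (dot γ (X i)) ^ 2 - 1 / n * ∑ i, F γ (dot γ (X i))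
        - 2 / n * ∑ i, ∑ j ∈ Finset.Ioi i, F γ (max (dot γ (X i)) (dot γ (X j))) := by
    intro γ
    have hm := (continuous_dot_right γ).measurable
    have := Measure.isProbabilityMeasure_map (μ := cardioid d k μ ρ) hm.aemeasurable
    have hs : NullSingletonClass ((cardioid d k μ ρ).map fun x => dot γ x) := by
      constructor
      intro t
      rw [Measure.map_apply hm (measurableSet_singleton t)]
      exact withDensity_absolutelyContinuous _ _ (hnull γ t)
    -- The projected law lives on [-1, 1], so the restriction in the definition of the statistic
    -- changes nothing.
    have hae : ∀ᵐ x ∂((cardioid d k μ ρ).map fun x => dot γ x), x ∈ Icc (-1 : ℝ) 1 :=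
      (ae_map_iff hm.aemeasurable measurableSet_Icc).2 (ae_of_all _ fun x => dot_mem_Icc γ x)
    have hFX : ∀ i, F γ (dot γ (X i)) = projCdf d k μ ρ γ (dot γ (X i)) := fun i =>
      (hF γ _ (dot_mem_Icc _ _)).symm
    have hFm : ∀ i j, F γ (max (dot γ (X i)) (dot γ (X j)))
        = projCdf d k μ ρ γ (max (dot γ (X i)) (dot γ (X j))) := fun i j =>
      (hF γ _ (by rcases max_choice (dot γ (X i)) (dot γ (X j)) with h | h <;> rw [h] <;>
        exact dot_mem_Icc _ _)).symm
    simp_rw [hFX, hFm]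
    rw [stieltjesComp_cvmWeight]
    unfold projCdf projEcdf
    rw [measure_cdf, Measure.restrict_eq_self_of_ae_mem hae]
    exact cramerVonMises_eq hn fun i => dot γ (X i)
  have c1 : ∀ x, Continuous fun γ => F γ (dot γ x) := fun x =>
    hFc.comp (continuous_id.prodMk (continuous_dot_left x))
  have c2 : ∀ x, Continuous fun γ => F γ (dot γ x) ^ 2 := fun x => (c1 x).pow 2
  have c3 : ∀ x y, Continuous fun γ => F γ (max (dot γ x) (dot γ y)) := fun x y =>
    hFc.comp (continuous_id.prodMk ((continuous_dot_left x).max (continuous_dot_left y)))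
  have i1 : Integrable (fun γ => 1 / (n : ℝ) * ∑ i, F γ (dot γ (X i))) (unif d) :=
    (integrable_finsetSum _ fun i _ => integrable_of_continuous (c1 _)).const_mul _
  have i2 : Integrable (fun γ => (n : ℝ) / 3 + ∑ i, F γ (dot γ (X i)) ^ 2) (unif d) :=
    (integrable_const _).add
      (integrable_finsetSum _ fun i _ => integrable_of_continuous (c2 _))
  have i3 : Integrable (fun γ => 2 / (n : ℝ) * ∑ i, ∑ j ∈ Finset.Ioi i,
      F γ (max (dot γ (X i)) (dot γ (X j)))) (unif d) :=
    (integrable_finsetSum _ fun i _ => integrable_finsetSum _ fun j _ =>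
      integrable_of_continuous (c3 _ _)).const_mul _
  have i4 := i2.sub i1
  simp only [Pi.sub_def] at i4
  -- The constant 1 in 1 - ψ is summed once per pair.
  have hcount : ∑ i : Fin n, ∑ j ∈ Finset.Ioi i, (1 : ℝ) = n * (n - 1) / 2 := by
    have h := sum_sum_eq_diag_add_Ioi (n := n) (fun _ _ => (1 : ℝ)) fun _ _ => rfl
    simp only [Finset.sum_const, Finset.card_univ, Fintype.card_fin, nsmul_eq_mul, mul_one] at h ⊢
    linarith
  rw [cvmUnifStat, projStat, ← integral_const_mul]
  simp_rw [inner]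
  rw [integral_sub i4 i3, integral_sub i2 i1, integral_add (integrable_const _)
      (integrable_finsetSum _ fun i _ => integrable_of_continuous (c2 _)),
    integral_const_mul, integral_const_mul,
    integral_finsetSum _ fun i _ => integrable_of_continuous (c2 _),
    integral_finsetSum _ fun i _ => integrable_of_continuous (c1 _),
    integral_finsetSum _ fun i _ => integrable_finsetSum _ fun j _ =>
      integrable_of_continuous (c3 _ _)]
  have e4 : ∀ i, ∫ γ, ∑ j ∈ Finset.Ioi i, F γ (max (dot γ (X i)) (dot γ (X j))) ∂(unif d)
      = ∑ j ∈ Finset.Ioi i, (1 - ψ (X i) (X j)) := fun i => by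
    rw [integral_finsetSum _ fun j _ => integrable_of_continuous (c3 _ _)]
    exact Finset.sum_congr rfl fun j _ => e3 _ _
  simp_rw [e4, e1, e2, Finset.sum_sub_distrib]
  rw [hcount]
  simp only [integral_const, probReal_univ, Finset.sum_const, Finset.card_univ, Fintype.card_fin,
    nsmul_eq_mul, smul_eq_mul]
  field_simp
  ring

end General

/-! ### Integration on the circle folded about a base angle. -/

section CircleIntegral

lemma circlePt_add_int_mul_two_pi (α : ℝ) (n : ℤ) : circlePt (α + n * (2 * π)) = circlePt α := by
  refine Subtype.ext ?_
  simp [circlePt, Real.cos_add_int_mul_two_pi, Real.sin_add_int_mul_two_pi]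

/-- Periodicity moves the window to (b - π, b + π), whose two halves are then folded together.
Measurability suffices, which allows indicators of caps. -/
lemma integral_surface_one_of_measurable {f : Sph 1 → ℝ} (hf : Measurable f) {C : ℝ}
    (hC : ∀ x, |f x| ≤ C) (b : ℝ) :
    ∫ x, f x ∂(surface 1)
      = ∫ α in (0 : ℝ)..π, (f (circlePt (b + α)) + f (circlePt (b - α))) := by
  have hm : Measurable fun α => f (circlePt α) := hf.comp continuous_circlePt.measurable
  have hint : ∀ (g : ℝ → ℝ), Measurable g → ∀ u v,
      IntervalIntegrable (fun α => f (circlePt (g α))) volume u v := fun g hg u v =>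
    ⟨integrable_of_abs_le (hm.comp hg) fun x => hC _,
      integrable_of_abs_le (hm.comp hg) fun x => hC _⟩
  have hper : Function.Periodic (fun α => f (circlePt α)) (2 * π) := fun α => by
    have := circlePt_add_int_mul_two_pi α 1
    simp only [Int.cast_one, one_mul] at this
    simp only [this]
  have h1 := hper.intervalIntegral_add_eq (-π) (b - π)
  rw [show -π + 2 * π = π by ring, show b - π + 2 * π = b + π by ring] at h1
  rw [surface_one_eq_map, integral_map continuous_circlePt.measurable.aemeasurable
    hf.aestronglyMeasurable, Measure.restrict_congr_set Ioo_ae_eq_Ioc,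
    ← intervalIntegral.integral_of_le (by linarith [Real.pi_pos]), h1]
  have h2 : ∫ α in (0 : ℝ)..π, f (circlePt (b + α)) = ∫ α in b..(b + π), f (circlePt α) := by
    simpa using intervalIntegral.integral_comp_add_left (a := 0) (b := π)
      (fun α => f (circlePt α)) b
  have h3 : ∫ α in (0 : ℝ)..π, f (circlePt (b - α)) = ∫ α in (b - π)..b, f (circlePt α) := by
    simpa using intervalIntegral.integral_comp_sub_left (a := 0) (b := π)
      (fun α => f (circlePt α)) b
  rw [intervalIntegral.integral_add (hint _ (by fun_prop) _ _) (hint _ (by fun_prop) _ _), h2, h3,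
    add_comm (∫ α in b..(b + π), _), intervalIntegral.integral_add_adjacent_intervals (hint (fun α => α) measurable_id _ _)
      (hint (fun α => α) measurable_id _ _)]

lemma exists_abs_le_of_continuous {d : ℕ} {f : Sph d → ℝ} (hf : Continuous f) :
    ∃ C, ∀ x, |f x| ≤ C := by
  obtain ⟨C, hC⟩ := isCompact_univ.exists_bound_of_continuousOn hf.continuousOn
  exact ⟨C, fun x => hC x (mem_univ x)⟩

lemma integral_surface_one {f : Sph 1 → ℝ} (hf : Continuous f) (b : ℝ) :
    ∫ x, f x ∂(surface 1)
      = ∫ α in (0 : ℝ)..π, (f (circlePt (b + α)) + f (circlePt (b - α))) :=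
  let ⟨_, hC⟩ := exists_abs_le_of_continuous hf
  integral_surface_one_of_measurable hf.measurable hC b

lemma area_one : area 1 = 2 * π := by
  have h := integral_surface_one (f := fun _ => 1) continuous_const 0
  rw [integral_const, smul_eq_mul, mul_one] at h
  rw [area, h]
  norm_num
  ring

lemma integral_unif_one {f : Sph 1 → ℝ} (hf : Continuous f) (b : ℝ) :
    ∫ x, f x ∂(unif 1)
      = 1 / (2 * π) * ∫ α in (0 : ℝ)..π, (f (circlePt (b + α)) + f (circlePt (b - α))) := by
  rw [integral_unif, area_one, integral_surface_one hf b]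

lemma countable_setOf_cos_eq (t : ℝ) : {τ | Real.cos τ = t}.Countable := by
  by_cases h : ∃ τ, Real.cos τ = t
  · obtain ⟨τ, rfl⟩ := h
    refine ((countable_range fun n : ℤ => 2 * n * π + τ).union
      (countable_range fun n : ℤ => 2 * n * π - τ)).mono fun x hx => ?_
    rw [mem_ofPred_eq, eq_comm, Real.cos_eq_cos_iff] at hx
    obtain ⟨n, hn | hn⟩ := hx
    · exact .inl ⟨n, hn.symm⟩
    · exact .inr ⟨n, hn.symm⟩
  · convert countable_empty
    exact eq_empty_of_forall_notMem fun x hx => h ⟨x, hx⟩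

lemma surface_one_dot_eq_null (γ : Sph 1) (t : ℝ) : surface 1 {x | dot γ x = t} = 0 := by
  obtain ⟨a, rfl⟩ := exists_circlePt_eq γ
  have hm : MeasurableSet {x | dot (circlePt a) x = t} :=
    (continuous_dot_right _).measurable (measurableSet_singleton t)
  rw [surface_one_eq_map, Measure.map_apply continuous_circlePt.measurable hm]
  refine Measure.absolutelyContinuous_of_le Measure.restrict_le_self (Countable.measure_zero ?_ _)
  have : circlePt ⁻¹' {x | dot (circlePt a) x = t} = (fun α => a - α) ⁻¹' {τ | Real.cos τ = t} := by
    ext α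
    simp only [mem_preimage, mem_ofPred_eq, dot_circlePt]
  rw [this]
  exact (countable_setOf_cos_eq t).preimage_of_injOn sub_right_injective.injOn

/-- Two points of the circle are symmetric with respect to a bisector. -/
lemma exists_bisector (x y : Sph 1) : ∃ b β, β ∈ Icc 0 (π / 2) ∧
    ((x = circlePt (b + β) ∧ y = circlePt (b - β)) ∨
      (x = circlePt (b - β) ∧ y = circlePt (b + β))) := by
  obtain ⟨θ, rfl⟩ := exists_circlePt_eq x
  obtain ⟨η, rfl⟩ := exists_circlePt_eq y
  -- The half-angle β is half the geodesic distance between the points.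
  have hβ : Real.arccos (Real.cos (θ - η)) / 2 ∈ Icc 0 (π / 2) :=
    ⟨by linarith [Real.arccos_nonneg (Real.cos (θ - η))],
      by linarith [Real.arccos_le_pi (Real.cos (θ - η))]⟩
  have hc := Real.cos_arccos (Real.neg_one_le_cos (θ - η)) (Real.cos_le_one _)
  set ζ := Real.arccos (Real.cos (θ - η)) with hζ
  obtain ⟨n, hn | hn⟩ := Real.cos_eq_cos_iff.1 hc
  · refine ⟨θ - ζ / 2, ζ / 2, hβ, .inl ⟨by congr 1; ring, ?_⟩⟩
    rw [← circlePt_add_int_mul_two_pi η n]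
    congr 1
    linarith
  · refine ⟨θ + ζ / 2, ζ / 2, hβ, .inr ⟨by congr 1; ring, ?_⟩⟩
    rw [← circlePt_add_int_mul_two_pi η n]
    congr 1
    linarith

end CircleIntegral

/-! ### The circular cardioid distribution of order k. -/

section CircleCardioid

variable {k : ℕ}

lemma cheb_cos (k : ℕ) (θ : ℝ) : cheb k (Real.cos θ) = Real.cos (k * θ) := by
  rw [cheb, Polynomial.Chebyshev.T_real_cos, Int.cast_natCast]

@[fun_prop]
lemma continuous_cheb (k : ℕ) : Continuous (cheb k) := (Polynomial.Chebyshev.T ℝ k).continuous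

lemma sphPolyNormalized_one (k : ℕ) : sphPolyNormalized 1 k = cheb k := by
  ext x
  have : cheb k 1 = 1 := by simpa using cheb_cos k 0
  simp [sphPolyNormalized, sphPoly, this]

lemma abs_cheb_dot_le_one (k : ℕ) (x y : Sph 1) : |cheb k (dot x y)| ≤ 1 := by
  obtain ⟨θ, rfl⟩ := exists_circlePt_eq x
  obtain ⟨η, rfl⟩ := exists_circlePt_eq y
  rw [dot_circlePt, cheb_cos]
  exact Real.abs_cos_le_one _

lemma one_add_mul_nonneg_of_abs_le_one {ρ c : ℝ} (hρ : ρ ∈ Icc (-1 : ℝ) 1) (hc : |c| ≤ 1) :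
    0 ≤ 1 + ρ * c := by
  have h : |ρ * c| ≤ 1 := by
    rw [abs_mul]; exact mul_le_one₀ (abs_le.2 hρ) (abs_nonneg _) hc
  linarith [(abs_le.1 h).1]

/-- Folding about b separates the variables: the part odd in α cancels. -/
lemma cos_mul_add_add_cos_mul_sub (k : ℕ) (b m α : ℝ) :
    Real.cos (k * (b + α - m)) + Real.cos (k * (b - α - m))
      = 2 * Real.cos (k * (b - m)) * Real.cos (k * α) := by
  rw [show (k : ℝ) * (b + α - m) = k * (b - m) + k * α by ring,
    show (k : ℝ) * (b - α - m) = k * (b - m) - k * α by ring, Real.cos_add, Real.cos_sub]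
  ring

lemma hasDerivAt_sin_mul (k : ℕ) (α : ℝ) :
    HasDerivAt (fun α : ℝ => Real.sin (k * α)) (Real.cos (k * α) * k) α := by
  simpa using ((hasDerivAt_id α).const_mul (k : ℝ)).sin

lemma hasDerivAt_cos_mul (k : ℕ) (α : ℝ) :
    HasDerivAt (fun α : ℝ => Real.cos (k * α)) (-Real.sin (k * α) * k) α := by
  simpa using ((hasDerivAt_id α).const_mul (k : ℝ)).cos

lemma integral_cos_mul (hk : 1 ≤ k) (τ : ℝ) :
    ∫ α in τ..π, Real.cos (k * α) = -Real.sin (k * τ) / k := by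
  have hk' : (k : ℝ) ≠ 0 := by positivity
  rw [intervalIntegral.integral_comp_mul_left _ hk', integral_cos, Real.sin_nat_mul_pi, smul_eq_mul]
  ring

/-- The distribution function of the projection on `γ` of the circular cardioid distribution. -/
def circleCdf (k : ℕ) (μ : Sph 1) (ρ : ℝ) (γ : Sph 1) (t : ℝ) : ℝ :=
  1 - Real.arccos t / π - ρ * cheb k (dot γ μ) * Real.sin (k * Real.arccos t) / (k * π)

lemma continuous_circleCdf (k : ℕ) (μ : Sph 1) (ρ : ℝ) :
    Continuous fun p : Sph 1 × ℝ => circleCdf k μ ρ p.1 p.2 := by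
  have h1 : Continuous fun p : Sph 1 × ℝ => Real.arccos p.2 :=
    Real.continuous_arccos.comp continuous_snd
  have h2 : Continuous fun p : Sph 1 × ℝ => dot p.1 μ :=
    (continuous_dot_left μ).comp continuous_fst
  unfold circleCdf
  fun_prop

lemma continuous_circleCdf_comp (k : ℕ) (μ : Sph 1) (ρ : ℝ) {t : Sph 1 → ℝ} (ht : Continuous t) :
    Continuous fun γ => circleCdf k μ ρ γ (t γ) := by
  have h1 : Continuous fun γ => Real.arccos (t γ) := Real.continuous_arccos.comp ht
  have h2 : Continuous fun γ => dot γ μ := continuous_dot_left μ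
  unfold circleCdf
  fun_prop

/-- The arccosine of the cosine is kept because it simplifies only for τ in [0, π]. -/
lemma circleCdf_circlePt (k : ℕ) (ρ m a τ : ℝ) :
    circleCdf k (circlePt m) ρ (circlePt a) (Real.cos τ)
      = 1 - Real.arccos (Real.cos τ) / π - ρ * Real.cos (k * (a - m))
        * Real.sin (k * Real.arccos (Real.cos τ)) / (k * π) := by
  rw [circleCdf, dot_circlePt, cheb_cos]

variable {ρ : ℝ}

lemma integral_cheb_dot (hk : 1 ≤ k) (μ : Sph 1) :
    ∫ x, cheb k (dot x μ) ∂(surface 1) = 0 := by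
  obtain ⟨m, rfl⟩ := exists_circlePt_eq μ
  have hcont : Continuous fun x => cheb k (dot x (circlePt m)) :=
    (continuous_cheb k).comp (continuous_dot_left _)
  rw [integral_surface_one hcont m]
  simp_rw [dot_circlePt, cheb_cos, cos_mul_add_add_cos_mul_sub]
  rw [intervalIntegral.integral_const_mul, integral_cos_mul hk]
  simp

/-- Folded about γ, the cap becomes the interval of angles from arccos t to π, on which the two
density values add up to a constant plus a multiple of cos(kα). -/
lemma projCdf_one_eq (hk : 1 ≤ k) (hρ : ρ ∈ Icc (-1 : ℝ) 1) (μ γ : Sph 1) {t : ℝ}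
    (ht : t ∈ Icc (-1 : ℝ) 1) : projCdf 1 k μ ρ γ t = circleCdf k μ ρ γ t := by
  have hk' : (k : ℝ) ≠ 0 := by positivity
  have h0 : ∀ x, 0 ≤ 1 + ρ * sphPolyNormalized 1 k (dot x μ) := fun x => by
    rw [sphPolyNormalized_one]
    exact one_add_mul_nonneg_of_abs_le_one hρ (abs_cheb_dot_le_one k x μ)
  have h1 : ∫ x, sphPolyNormalized 1 k (dot x μ) ∂(surface 1) = 0 := by
    rw [sphPolyNormalized_one]; exact integral_cheb_dot hk μ
  have hs : MeasurableSet {x | dot γ x ≤ t} := (continuous_dot_right γ).measurable measurableSet_Iic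
  have hcont : Continuous fun x => 1 + ρ * cheb k (dot x μ) :=
    continuous_const.add
      (continuous_const.mul ((continuous_cheb k).comp (continuous_dot_left μ)))
  obtain ⟨C, hC⟩ := exists_abs_le_of_continuous hcont
  obtain ⟨a, rfl⟩ := exists_circlePt_eq γ
  obtain ⟨m, rfl⟩ := exists_circlePt_eq μ
  rw [projCdf_eq_setIntegral (by rw [sphPolyNormalized_one]; fun_prop) h0 h1, area_one,
    sphPolyNormalized_one, ← integral_indicator hs, integral_surface_one_of_measurable
      (hcont.measurable.indicator hs) (C := C) _ a]
  · have hτ := Real.cos_arccos ht.1 ht.2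
    set τ := Real.arccos t with hτ'
    have hτ0 : 0 ≤ τ := Real.arccos_nonneg t
    have hτπ : τ ≤ π := Real.arccos_le_pi t
    have e : ∀ α ∈ Ioc 0 π,
        ({x | dot (circlePt a) x ≤ t}.indicator (fun x => 1 + ρ * cheb k (dot x (circlePt m)))
          (circlePt (a + α)) +
        {x | dot (circlePt a) x ≤ t}.indicator (fun x => 1 + ρ * cheb k (dot x (circlePt m)))
          (circlePt (a - α)))
        = (Ici τ).indicator (fun α => 2 + 2 * ρ * Real.cos (k * (a - m)) * Real.cos (k * α)) α := by
      intro α hα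
      have h2 := cos_mul_add_add_cos_mul_sub k a m α
      have h3 : Real.cos α ≤ t ↔ τ ≤ α := by
        rw [← hτ]
        exact Real.strictAntiOn_cos.le_iff_ge ⟨hα.1.le, hα.2⟩ ⟨hτ0, hτπ⟩
      simp only [indicator_apply, mem_ofPred_eq, dot_circlePt, sub_add_cancel_left, sub_sub_cancel,
        Real.cos_neg, h3, mem_Ici, cheb_cos]
      split_ifs
      · linear_combination ρ * h2
      · simp
    rw [intervalIntegral.integral_of_le Real.pi_pos.le, setIntegral_congr_fun measurableSet_Ioc e,
      integral_indicator measurableSet_Ici, Measure.restrict_restrict measurableSet_Ici,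
      Measure.restrict_congr_set ((Ioi_ae_eq_Ici (μ := volume)).symm.inter (ae_eq_refl (Ioc 0 π))),
      inter_comm, Ioc_inter_Ioi, max_eq_right hτ0, ← intervalIntegral.integral_of_le hτπ,
      intervalIntegral.integral_add (by simp) (Continuous.intervalIntegrable (by fun_prop) _ _),
      intervalIntegral.integral_const_mul, integral_cos_mul hk, intervalIntegral.integral_const,
      circleCdf, ← hτ', dot_circlePt, cheb_cos, smul_eq_mul]
    field_simp
    ring
  · intro x
    refine le_trans ?_ (hC x)
    rw [← Real.norm_eq_abs, ← Real.norm_eq_abs]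
    exact norm_indicator_le_norm_self _ _

/-- Mean of the projected distribution function over the directions. -/
lemma integral_circleCdf (hk : 1 ≤ k) (μ x : Sph 1) :
    ∫ γ, circleCdf k μ ρ γ (dot γ x) ∂(unif 1) = 1 / 2 := by
  have hk' : (k : ℝ) ≠ 0 := by positivity
  obtain ⟨θ, rfl⟩ := exists_circlePt_eq x
  obtain ⟨m, rfl⟩ := exists_circlePt_eq μ
  rw [integral_unif_one (continuous_circleCdf_comp k _ ρ (continuous_dot_left _)) θ]
  have e : ∀ α ∈ uIcc 0 π, circleCdf k (circlePt m) ρ (circlePt (θ + α))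
        (dot (circlePt (θ + α)) (circlePt θ))
      + circleCdf k (circlePt m) ρ (circlePt (θ - α)) (dot (circlePt (θ - α)) (circlePt θ))
      = 2 * (1 - α / π) - 2 * ρ * Real.cos (k * (θ - m)) / (k * π)
        * (Real.cos (k * α) * Real.sin (k * α)) := by
    intro α hα
    rw [uIcc_of_le Real.pi_pos.le] at hα
    have h2 := cos_mul_add_add_cos_mul_sub k θ m α
    simp only [dot_circlePt, add_sub_cancel_left, sub_sub_cancel_left, Real.cos_neg,
      circleCdf_circlePt, Real.arccos_cos hα.1 hα.2]
    linear_combination -ρ * Real.sin (k * α) / (k * π) * h2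
  rw [intervalIntegral.integral_congr e, intervalIntegral.integral_eq_sub_of_hasDerivAt
    (f := fun α => 2 * (α - α ^ 2 / (2 * π)) - 2 * ρ * Real.cos (k * (θ - m)) / (k * π)
      * (Real.sin (k * α) ^ 2 / (2 * k)))]
  · simp only [Real.sin_nat_mul_pi, mul_zero, Real.sin_zero]
    field_simp
    ring
  · intro α _
    have h1 := ((hasDerivAt_id' α).fun_sub (((hasDerivAt_id' α).fun_pow 2).div_const (2 * π))).const_mul 2
    have h2 := (((hasDerivAt_sin_mul k α).fun_pow 2).div_const (2 * k : ℝ)).const_mul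
      (2 * ρ * Real.cos (k * (θ - m)) / (k * π))
    refine (h1.fun_sub h2).congr_deriv ?_
    field_simp
    ring
  · exact Continuous.intervalIntegrable (by fun_prop) _ _

/-- Second moment of the projected distribution function over the directions. -/
lemma integral_circleCdf_sq (hk : 1 ≤ k) (μ x : Sph 1) :
    ∫ γ, circleCdf k μ ρ γ (dot γ x) ^ 2 ∂(unif 1) = 1 / 3 - phiCircle k ρ (dot x μ) := by
  have hk' : (k : ℝ) ≠ 0 := by positivity
  obtain ⟨θ, rfl⟩ := exists_circlePt_eq x
  obtain ⟨m, rfl⟩ := exists_circlePt_eq μ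
  have hcont : Continuous fun γ =>
      circleCdf k (circlePt m) ρ γ (dot γ (circlePt θ)) ^ 2 :=
    (continuous_circleCdf_comp k _ ρ (continuous_dot_left _)).pow 2
  rw [integral_unif_one hcont θ, phiCircle, dot_circlePt, cheb_cos,
    cheb_cos]
  set c := Real.cos (k * (θ - m)) with hc
  have hc2 : Real.cos ((2 * k : ℕ) * (θ - m)) = 2 * c ^ 2 - 1 := by
    rw [hc, ← Real.cos_two_mul]; push_cast; ring_nf
  rw [hc2]
  have e : ∀ α ∈ uIcc 0 π, (circleCdf k (circlePt m) ρ (circlePt (θ + α))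
        (dot (circlePt (θ + α)) (circlePt θ))) ^ 2
      + (circleCdf k (circlePt m) ρ (circlePt (θ - α)) (dot (circlePt (θ - α)) (circlePt θ))) ^ 2
      = 2 * (1 - α / π) ^ 2 - 4 * ρ * c / (k * π)
          * ((1 - α / π) * (Real.sin (k * α) * Real.cos (k * α)))
        + 2 * ρ ^ 2 / (k * π) ^ 2 * (c ^ 2 * (Real.sin (k * α) ^ 2 * Real.cos (k * α) ^ 2)
          + (1 - c ^ 2) * Real.sin (k * α) ^ 4) := by
    intro α hα
    rw [uIcc_of_le Real.pi_pos.le] at hα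
    simp only [dot_circlePt, add_sub_cancel_left, sub_sub_cancel_left, Real.cos_neg,
      circleCdf_circlePt, Real.arccos_cos hα.1 hα.2]
    rw [show (k : ℝ) * (θ + α - m) = k * (θ - m) + k * α by ring,
      show (k : ℝ) * (θ - α - m) = k * (θ - m) - k * α by ring, Real.cos_add, Real.cos_sub, ← hc,
      ← Real.sin_sq_add_cos_sq (k * (θ - m)), ← hc]
    field_simp
    ring
  rw [intervalIntegral.integral_congr e, intervalIntegral.integral_eq_sub_of_hasDerivAt
    -- With s = sin(kα) and co = cos(kα), the primitive combines those of (1 - α/π)², (1 - α/π) s co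
    -- (by parts), s² co², and s⁴ = s² - s² co². These four are checked below as `p4`, `p1`, `p2`
    -- and `p3`.
    (f := fun α => -(2 * π / 3) * (1 - α / π) ^ 3 - 4 * ρ * c / (k * π)
          * (-(1 - α / π) * (1 - 2 * Real.sin (k * α) ^ 2) / (4 * k)
            - Real.sin (k * α) * Real.cos (k * α) / (4 * k ^ 2 * π))
        + 2 * ρ ^ 2 / (k * π) ^ 2 * (c ^ 2 * (α / 8 - Real.sin (k * α) * Real.cos (k * α)
            * (1 - 2 * Real.sin (k * α) ^ 2) / (8 * k))
          + (1 - c ^ 2) * (α / 2 - Real.sin (k * α) * Real.cos (k * α) / (2 * k)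
            - (α / 8 - Real.sin (k * α) * Real.cos (k * α)
            * (1 - 2 * Real.sin (k * α) ^ 2) / (8 * k)))))]
  · simp only [Real.sin_nat_mul_pi, mul_zero, Real.sin_zero]
    field_simp
    ring
  · intro α _
    have hs := hasDerivAt_sin_mul k α
    have hco := hasDerivAt_cos_mul k α
    have hA := ((hasDerivAt_id' α).div_const π).const_sub 1
    have hsc := hs.fun_mul hco
    have hq := ((hs.fun_pow 2).const_mul 2).const_sub 1
    have h1 := (hA.fun_pow 3).const_mul (-(2 * π / 3))
    have h2 := (((hA.fun_neg.fun_mul hq).div_const (4 * k : ℝ)).fun_sub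
      (hsc.div_const (4 * k ^ 2 * π : ℝ))).const_mul (4 * ρ * c / (k * π))
    have h3 := ((hasDerivAt_id' α).div_const 8).fun_sub ((hsc.fun_mul hq).div_const (8 * k : ℝ))
    have h4 := (((hasDerivAt_id' α).div_const 2).fun_sub (hsc.div_const (2 * k : ℝ))).fun_sub h3
    have h5 := ((h3.const_mul (c ^ 2)).fun_add (h4.const_mul (1 - c ^ 2))).const_mul
      (2 * ρ ^ 2 / (k * π) ^ 2)
    refine ((h1.fun_sub h2).fun_add h5).congr_deriv ?_
    have hcs := Real.sin_sq_add_cos_sq (k * α)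
    generalize Real.sin (k * α) = u at hcs ⊢
    generalize Real.cos (k * α) = v at hcs ⊢
    have p1 : (- -(1 / π) * (1 - 2 * u ^ 2) + -(1 - α / π)
        * -(2 * (((2 : ℕ) : ℝ) * u ^ (2 - 1) * (v * k)))) / (4 * k)
        - (v * k * v + u * (-u * k)) / (4 * k ^ 2 * π) = (1 - α / π) * (u * v) := by
      field_simp
      grind
    have p2 : 1 / 8 - ((v * k * v + u * (-u * k)) * (1 - 2 * u ^ 2)
        + u * v * -(2 * (((2 : ℕ) : ℝ) * u ^ (2 - 1) * (v * k)))) / (8 * k) = u ^ 2 * v ^ 2 := by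
      field_simp
      grind
    have p3 : 1 / 2 - (v * k * v + u * (-u * k)) / (2 * k) - u ^ 2 * v ^ 2 = u ^ 4 := by
      field_simp
      grind
    have p4 : -(2 * π / 3) * (((3 : ℕ) : ℝ) * (1 - α / π) ^ (3 - 1) * -(1 / π))
        = 2 * (1 - α / π) ^ 2 := by
      generalize 1 - α / π = w
      field_simp
      norm_num
    rw [p1, p2, p3, p4]
  · exact Continuous.intervalIntegrable (by fun_prop) _ _

lemma psiCircle_symm (k : ℕ) (ρ m m' t : ℝ) : psiCircle k ρ m m' t = psiCircle k ρ m' m t := by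
  rw [psiCircle, psiCircle, add_comm m m']

/-- The sum of the cosines of b ± β - m is 2 cos β cos(b - m), and the square root in the kernel is
2 cos β, so the Chebyshev argument is cos(b - m). -/
lemma psiCircle_of_bisector {b β m : ℝ} (hβ : β ∈ Icc 0 (π / 2)) :
    psiCircle k ρ (dot (circlePt (b + β)) (circlePt m)) (dot (circlePt (b - β)) (circlePt m))
    (dot (circlePt (b + β)) (circlePt (b - β)))
    = psiCvM₁ (2 * β) - ρ * ((π - 2 * β) / (2 * π ^ 2 * k) * Real.cos (k * (b - m))
      * Real.sin (k * β)) := by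
  simp only [dot_circlePt]
  rw [psiCircle, show b + β - (b - β) = 2 * β by ring,
    Real.arccos_cos (by linarith [hβ.1]) (by linarith [hβ.2]),
    show (k : ℝ) * (2 * β) / 2 = k * β by ring]
  -- For antipodal points the quotient degenerates, but its prefactor π - 2β is zero.
  rcases eq_or_ne β (π / 2) with rfl | hne
  · rw [show π - 2 * (π / 2) = 0 by ring]; simp
  · have hpos : 0 < Real.cos β := Real.cos_pos_of_mem_Ioo
      ⟨by linarith [hβ.1, Real.pi_pos], lt_of_le_of_ne hβ.2 hne⟩
    have h1 : √(2 * (1 + Real.cos (2 * β))) = 2 * Real.cos β := by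
      rw [Real.cos_two_mul, show 2 * (1 + (2 * Real.cos β ^ 2 - 1)) = (2 * Real.cos β) ^ 2 by ring,
        Real.sqrt_sq (by positivity)]
    have h2 : (Real.cos (b + β - m) + Real.cos (b - β - m)) / (2 * Real.cos β)
        = Real.cos (b - m) := by
      rw [show b + β - m = (b - m) + β by ring, show b - β - m = (b - m) - β by ring,
        Real.cos_add (b - m), Real.cos_sub (b - m)]
      field_simp
      ring
    rw [h1, h2, cheb_cos]

/-- Split at α = β and write the product as a sum of sines. The term in β - 2α integrates to zero on
each piece, because its primitive takes equal values at both ends. The constant sin(kβ) enters with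
opposite signs over lengths β and π - β, whence π - 2β. -/
lemma integral_cos_mul_sin_abs_sub (hk : 1 ≤ k) {β : ℝ} (hβ : β ∈ Icc 0 π) (C : ℝ) :
    ∫ α in (0 : ℝ)..π, (2 * (1 - |α - β| / π) - C * (Real.cos (k * α) * Real.sin (k * |α - β|)))
      = 2 * π - (β ^ 2 + (π - β) ^ 2) / π + C * ((π - 2 * β) * Real.sin (k * β) / 2) := by
  have hk' : (k : ℝ) ≠ 0 := by positivity
  have hint : ∀ u v, IntervalIntegrable (fun α => 2 * (1 - |α - β| / π)
      - C * (Real.cos (k * α) * Real.sin (k * |α - β|))) volume u v := fun u v =>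
    Continuous.intervalIntegrable (by fun_prop) _ _
  rw [← intervalIntegral.integral_add_adjacent_intervals (hint 0 β) (hint β π)]
  have hE : ∀ α, HasDerivAt (fun α : ℝ => Real.cos (k * (β - 2 * α)))
      (-Real.sin (k * (β - 2 * α)) * (k * -2)) α := fun α => by
    simpa using ((((hasDerivAt_id' α).const_mul 2).const_sub β).const_mul (k : ℝ)).cos
  have hprod : ∀ α, Real.cos (k * α) * Real.sin (k * (β - α))
      = (Real.sin (k * β) + Real.sin (k * (β - 2 * α))) / 2 := fun α => by
    rw [show (k : ℝ) * β = k * α + k * (β - α) by ring,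
      show (k : ℝ) * (β - 2 * α) = k * (β - α) - k * α by ring, Real.sin_add, Real.sin_sub]
    ring
  have i1 : ∫ α in (0 : ℝ)..β, (2 * (1 - |α - β| / π)
      - C * (Real.cos (k * α) * Real.sin (k * |α - β|)))
      = 2 * β - β ^ 2 / π
        - C * (β * Real.sin (k * β) / 2) := by
    have e1 : ∀ α ∈ uIcc 0 β, (2 * (1 - |α - β| / π)
        - C * (Real.cos (k * α) * Real.sin (k * |α - β|)))
        = 2 * (1 - (β - α) / π) - C
          * ((Real.sin (k * β) + Real.sin (k * (β - 2 * α))) / 2) := by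
      intro α hα
      rw [uIcc_of_le hβ.1] at hα
      rw [abs_sub_comm, abs_of_nonneg (sub_nonneg.2 hα.2), hprod]
    rw [intervalIntegral.integral_congr e1, intervalIntegral.integral_eq_sub_of_hasDerivAt
      (f := fun α => 2 * α + (β - α) ^ 2 / π - C
          * ((Real.sin (k * β) * α + Real.cos (k * (β - 2 * α)) / (2 * k)) / 2))]
    · rw [show (k : ℝ) * (β - 2 * β) = -(k * (β - 2 * 0)) by ring, Real.cos_neg]
      field_simp
      ring
    · intro α _
      have h1 := ((hasDerivAt_id' α).const_mul 2).fun_add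
        ((((hasDerivAt_id' α).const_sub β).fun_pow 2).div_const π)
      have h2 := ((((hasDerivAt_id' α).const_mul (Real.sin (k * β))).fun_add
        ((hE α).div_const (2 * k : ℝ))).div_const 2).const_mul
        C
      refine (h1.fun_sub h2).congr_deriv ?_
      field_simp
      ring
    · exact Continuous.intervalIntegrable (by fun_prop) _ _
  have i2 : ∫ α in β..π, (2 * (1 - |α - β| / π)
      - C * (Real.cos (k * α) * Real.sin (k * |α - β|)))
      = 2 * (π - β) - (π - β) ^ 2 / π
        + C * ((π - β) * Real.sin (k * β) / 2) := by
    have e1 : ∀ α ∈ uIcc β π, (2 * (1 - |α - β| / π)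
        - C * (Real.cos (k * α) * Real.sin (k * |α - β|)))
        = 2 * (1 - (α - β) / π) + C
          * ((Real.sin (k * β) + Real.sin (k * (β - 2 * α))) / 2) := by
      intro α hα
      rw [uIcc_of_le hβ.2] at hα
      rw [abs_of_nonneg (sub_nonneg.2 hα.1), ← hprod,
        show (k : ℝ) * (β - α) = -(k * (α - β)) by ring, Real.sin_neg]
      ring
    rw [intervalIntegral.integral_congr e1, intervalIntegral.integral_eq_sub_of_hasDerivAt
      (f := fun α => 2 * α - (α - β) ^ 2 / π + C
          * ((Real.sin (k * β) * α + Real.cos (k * (β - 2 * α)) / (2 * k)) / 2))]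
    · rw [show (k : ℝ) * (β - 2 * β) = -(k * β) by ring, Real.cos_neg,
        show (k : ℝ) * (β - 2 * π) = k * β - k * (2 * π) by ring, Real.cos_sub_nat_mul_two_pi]
      field_simp
      ring
    · intro α _
      have h1 := ((hasDerivAt_id' α).const_mul 2).fun_sub
        ((((hasDerivAt_id' α).sub_const β).fun_pow 2).div_const π)
      have h2 := ((((hasDerivAt_id' α).const_mul (Real.sin (k * β))).fun_add
        ((hE α).div_const (2 * k : ℝ))).div_const 2).const_mul
        C
      refine (h1.fun_add h2).congr_deriv ?_
      field_simp
      ring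
    · exact Continuous.intervalIntegrable (by fun_prop) _ _
  rw [i1, i2]
  ring

/-- Mean of the larger of two values of the projected distribution function. -/
lemma integral_circleCdf_max (hk : 1 ≤ k) (μ x y : Sph 1) :
    ∫ γ, circleCdf k μ ρ γ (max (dot γ x) (dot γ y)) ∂(unif 1)
      = 1 - psiCircle k ρ (dot x μ) (dot y μ) (dot x y) := by
  have hk' : (k : ℝ) ≠ 0 := by positivity
  obtain ⟨b, β, hβ, h⟩ := exists_bisector x y
  -- Both sides are symmetric in x and y.
  wlog hxy : x = circlePt (b + β) ∧ y = circlePt (b - β) generalizing x y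
  · have := this y x (h.symm.imp And.symm And.symm) (h.resolve_left hxy).symm
    rw [dot_comm x y, psiCircle_symm, ← this]
    simp_rw [max_comm]
  obtain ⟨rfl, rfl⟩ := hxy
  clear h
  obtain ⟨m, rfl⟩ := exists_circlePt_eq μ
  have hcont : Continuous fun γ => circleCdf k (circlePt m) ρ γ
      (max (dot γ (circlePt (b + β))) (dot γ (circlePt (b - β)))) :=
    continuous_circleCdf_comp k _ ρ ((continuous_dot_left _).max (continuous_dot_left _))
  rw [psiCircle_of_bisector hβ, integral_unif_one hcont b]
  have e : ∀ α ∈ Icc 0 π, circleCdf k (circlePt m) ρ (circlePt (b + α))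
        (max (dot (circlePt (b + α)) (circlePt (b + β)))
          (dot (circlePt (b + α)) (circlePt (b - β))))
      + circleCdf k (circlePt m) ρ (circlePt (b - α))
        (max (dot (circlePt (b - α)) (circlePt (b + β)))
          (dot (circlePt (b - α)) (circlePt (b - β))))
      = 2 * (1 - |α - β| / π) - 2 * ρ * Real.cos (k * (b - m)) / (k * π)
        * (Real.cos (k * α) * Real.sin (k * |α - β|)) := by
    intro α hα
    have h2 := cos_mul_add_add_cos_mul_sub k b m α
    have hβ' : β ∈ Icc 0 π := ⟨hβ.1, by linarith [hβ.2, Real.pi_pos]⟩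
    -- The larger projection is onto the sample point on the same side of the bisector as γ; the
    -- difference of the cosines is 2 sin α sin β ≥ 0.
    have h3 : Real.cos (α + β) ≤ Real.cos |α - β| := by
      rw [Real.cos_abs, Real.cos_add, Real.cos_sub]
      linarith [mul_nonneg (Real.sin_nonneg_of_mem_Icc hα) (Real.sin_nonneg_of_mem_Icc hβ')]
    have h4 : |α - β| ≤ π := abs_le.2 ⟨by linarith [hα.1, hβ'.2], by linarith [hα.2, hβ'.1]⟩
    simp only [dot_circlePt]
    rw [show b + α - (b + β) = α - β by ring, show b + α - (b - β) = α + β by ring,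
      show b - α - (b + β) = -(α + β) by ring, show b - α - (b - β) = -(α - β) by ring,
      Real.cos_neg, Real.cos_neg, ← Real.cos_abs (α - β), max_eq_left h3, max_eq_right h3,
      circleCdf_circlePt, circleCdf_circlePt, Real.arccos_cos (abs_nonneg _) h4]
    linear_combination -ρ * Real.sin (k * |α - β|) / (k * π) * h2
  rw [intervalIntegral.integral_congr (by rwa [uIcc_of_le Real.pi_pos.le])]
  rw [integral_cos_mul_sin_abs_sub hk ⟨hβ.1, by linarith [hβ.2, Real.pi_pos]⟩, psiCvM₁]
  field_simp
  ring

/-- The circular case. -/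
theorem cvmUnifStat_circle {n : ℕ} (hn : 1 ≤ n) (hρ : ρ ∈ Icc (-1 : ℝ) 1) (hk : 1 ≤ k)
    (μ : Sph 1) (X : Fin n → Sph 1) :
    cvmUnifStat k μ ρ X = (3 - 2 * (n : ℝ)) / 6 - ∑ i, phiCircle k ρ (dot (X i) μ)
      + 2 / (n : ℝ) * ∑ i, ∑ j ∈ Finset.Ioi i,
          psiCircle k ρ (dot (X i) μ) (dot (X j) μ) (dot (X i) (X j)) :=
  cvmUnifStat_eq_of_kernels hn X (by rw [sphPolyNormalized_one]; fun_prop)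
    (fun x => by
      rw [sphPolyNormalized_one]
      exact one_add_mul_nonneg_of_abs_le_one hρ (abs_cheb_dot_le_one k x μ))
    (by rw [sphPolyNormalized_one]; exact integral_cheb_dot hk μ) surface_one_dot_eq_null
    (fun γ t ht => projCdf_one_eq hk hρ μ γ ht) (continuous_circleCdf k μ ρ)
    (φ := fun x => phiCircle k ρ (dot x μ))
    (ψ := fun x y => psiCircle k ρ (dot x μ) (dot y μ) (dot x y))
    (integral_circleCdf hk μ) (integral_circleCdf_sq hk μ) (integral_circleCdf_max hk μ)

end CircleCardioid

/-! ### Integration on the 2-sphere in adapted frames. -/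

section SphereIntegral

variable (b : OrthonormalBasis (Fin 3) ℝ (EuclideanSpace ℝ (Fin 3)))

instance : IsFiniteMeasure sphericalMeasure := by
  let b := EuclideanSpace.basisFun (Fin 3) ℝ
  constructor
  have h : sphericalMeasure univ = surface 2 univ := by
    rw [surface_two_eq_map b, Measure.map_apply (continuous_spherePt b).measurable .univ,
      preimage_univ]
  rw [h]
  exact measure_lt_top _ _

lemma integral_surface_two {f : Sph 2 → ℝ} (hf : Measurable f) {C : ℝ} (hC : ∀ x, |f x| ≤ C) :
    ∫ x, f x ∂(surface 2)
      = ∫ θ in (0 : ℝ)..π, Real.sin θ * ∫ φ in (-π)..π, f (spherePt b θ φ) := by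
  have hm := hf.comp (continuous_spherePt b).measurable
  have hint : Integrable (fun p : ℝ × ℝ => f (spherePt b p.1 p.2)) sphericalMeasure :=
    integrable_of_abs_le hm fun p => hC _
  rw [surface_two_eq_map b, integral_map (continuous_spherePt b).measurable.aemeasurable
    hf.aestronglyMeasurable]
  rw [sphericalMeasure] at hint ⊢
  rw [integral_prod _ hint, integral_withDensity_eq_integral_toReal_smul
      Real.measurable_sin.ennreal_ofReal (ae_of_all _ fun _ => ENNReal.ofReal_lt_top),
    intervalIntegral.integral_of_le Real.pi_pos.le, Measure.restrict_congr_set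
      (Ioo_ae_eq_Ioc (μ := volume) (a := 0) (b := π))]
  refine setIntegral_congr_fun measurableSet_Ioc fun θ hθ => ?_
  simp only
  rw [ENNReal.toReal_ofReal (Real.sin_nonneg_of_mem_Icc ⟨hθ.1.le, hθ.2⟩), smul_eq_mul,
    intervalIntegral.integral_of_le (by linarith [Real.pi_pos]), Measure.restrict_congr_set
      (Ioo_ae_eq_Ioc (μ := volume) (a := -π) (b := π))]

/-- Terms with a factor sin φ and odd powers of cos φ have mean zero; the second and fourth powers
have means 1/2 and 3/8. Degree four covers the squares and products that occur for k = 2. -/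
lemma integral_trig_polynomial (a₀ a₁ a₂ a₃ a₄ b₀ b₁ b₂ b₃ : ℝ) :
    ∫ φ in (-π)..π, (a₀ + a₁ * Real.cos φ + a₂ * Real.cos φ ^ 2 + a₃ * Real.cos φ ^ 3
      + a₄ * Real.cos φ ^ 4 + Real.sin φ * (b₀ + b₁ * Real.cos φ + b₂ * Real.cos φ ^ 2
        + b₃ * Real.cos φ ^ 3)) = 2 * π * (a₀ + a₂ / 2 + 3 * a₄ / 8) := by
  rw [intervalIntegral.integral_eq_sub_of_hasDerivAt (f := fun φ =>
    a₀ * φ + a₁ * Real.sin φ + a₂ * (φ / 2 + Real.sin φ * Real.cos φ / 2)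
      + a₃ * (Real.sin φ - Real.sin φ ^ 3 / 3)
      + a₄ * (3 / 8 * φ + 3 / 8 * (Real.sin φ * Real.cos φ) + Real.sin φ * Real.cos φ ^ 3 / 4)
      - (b₀ * Real.cos φ + b₁ * (Real.cos φ ^ 2 / 2) + b₂ * (Real.cos φ ^ 3 / 3)
        + b₃ * (Real.cos φ ^ 4 / 4)))]
  · simp only [Real.sin_neg, Real.cos_neg, Real.sin_pi]
    ring
  · intro φ _
    have hs := Real.hasDerivAt_sin φ
    have hc := Real.hasDerivAt_cos φ
    have hi := hasDerivAt_id' φ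
    have hsc := hs.fun_mul hc
    have h := ((((((hi.const_mul a₀).fun_add (hs.const_mul a₁)).fun_add
      (((hi.div_const 2).fun_add (hsc.div_const 2)).const_mul a₂)).fun_add
      ((hs.fun_sub ((hs.fun_pow 3).div_const 3)).const_mul a₃)).fun_add
      ((((hi.const_mul (3 / 8)).fun_add (hsc.const_mul (3 / 8))).fun_add
        ((hs.fun_mul (hc.fun_pow 3)).div_const 4)).const_mul a₄)).fun_sub
      ((((hc.const_mul b₀).fun_add (((hc.fun_pow 2).div_const 2).const_mul b₁)).fun_add
        (((hc.fun_pow 3).div_const 3).const_mul b₂)).fun_add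
        (((hc.fun_pow 4).div_const 4).const_mul b₃)))
    refine h.congr_deriv ?_
    have hcs := Real.sin_sq_add_cos_sq φ
    generalize Real.sin φ = u at hcs ⊢
    generalize Real.cos φ = v at hcs ⊢
    have hu : u ^ 2 = 1 - v ^ 2 := by linarith
    push_cast
    linear_combination (-a₂ / 2 - a₃ * v - a₄ * (3 / 8 + 3 / 4 * v ^ 2)) * hu
  · exact Continuous.intervalIntegrable (by fun_prop) _ _

lemma integral_sin_mul_comp_cos {P : ℝ → ℝ} (hP : Continuous P) (τ : ℝ) :
    ∫ θ in τ..π, Real.sin θ * P (Real.cos θ) = ∫ z in (-1 : ℝ)..Real.cos τ, P z := by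
  have h := intervalIntegral.integral_comp_mul_deriv (a := τ) (b := π) (f := Real.cos)
    (f' := fun θ => -Real.sin θ) (g := P) (fun θ _ => Real.hasDerivAt_cos θ)
    (by fun_prop) hP
  rw [Real.cos_pi] at h
  rw [intervalIntegral.integral_symm (Real.cos τ) (-1), ← h, ← intervalIntegral.integral_neg]
  refine intervalIntegral.integral_congr fun θ _ => ?_
  simp only [Function.comp_apply]
  ring

/-- Integral over the sphere of a function that is a trigonometric polynomial in the azimuth. -/
lemma integral_surface_two_of_trig {f : Sph 2 → ℝ} (hf : Continuous f)
    (a₀ a₁ a₂ a₃ a₄ b₀ b₁ b₂ b₃ : ℝ → ℝ)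
    (h : ∀ θ φ, f (spherePt b θ φ) = a₀ θ + a₁ θ * Real.cos φ + a₂ θ * Real.cos φ ^ 2
      + a₃ θ * Real.cos φ ^ 3 + a₄ θ * Real.cos φ ^ 4 + Real.sin φ * (b₀ θ + b₁ θ * Real.cos φ
        + b₂ θ * Real.cos φ ^ 2 + b₃ θ * Real.cos φ ^ 3))
    {P : ℝ → ℝ} (hP : Continuous P)
    (hPa : ∀ θ, a₀ θ + a₂ θ / 2 + 3 * a₄ θ / 8 = P (Real.cos θ)) :
    ∫ x, f x ∂(surface 2) = 2 * π * ∫ z in (-1 : ℝ)..1, P z := by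
  obtain ⟨C, hC⟩ := exists_abs_le_of_continuous hf
  have h1 := integral_sin_mul_comp_cos hP 0
  rw [Real.cos_zero] at h1
  rw [integral_surface_two b hf.measurable hC, ← h1, ← intervalIntegral.integral_const_mul]
  refine intervalIntegral.integral_congr fun θ _ => ?_
  simp_rw [h, integral_trig_polynomial, hPa]
  ring

lemma area_two : area 2 = 4 * π := by
  have h := integral_surface_two_of_trig (EuclideanSpace.basisFun (Fin 3) ℝ)
    (f := fun _ => 1) continuous_const (fun _ => 1) 0 0 0 0 0 0 0 0
    (by simp) (P := fun _ => 1) continuous_const (by simp)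
  rw [integral_const, smul_eq_mul, mul_one] at h
  rw [area, h]
  norm_num
  ring

/-- A frame starting at a given unit vector in which the last coordinate of another vanishes. -/
lemma exists_frame {e : EuclideanSpace ℝ (Fin 3)} (he : ‖e‖ = 1) (v : EuclideanSpace ℝ (Fin 3)) :
    ∃ b : OrthonormalBasis (Fin 3) ℝ (EuclideanSpace ℝ (Fin 3)), b 0 = e ∧ inner ℝ (b 2) v = 0 := by
  have hcard : Module.finrank ℝ (EuclideanSpace ℝ (Fin 3)) = Fintype.card (Fin 3) := by simp
  -- Gram–Schmidt keeps the unit vector e, and triangularity makes the last basis vector orthogonal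
  -- to v, even if v is parallel to e.
  let f : Fin 3 → EuclideanSpace ℝ (Fin 3) := ![e, v, 0]
  have h0 : InnerProductSpace.gramSchmidtNormed ℝ f 0 = e := by
    have : InnerProductSpace.gramSchmidt ℝ f 0 = e := InnerProductSpace.gramSchmidt_bot ℝ f
    rw [InnerProductSpace.gramSchmidtNormed, this, he]
    simp
  refine ⟨InnerProductSpace.gramSchmidtOrthonormalBasis hcard f, ?_, ?_⟩
  · rw [InnerProductSpace.gramSchmidtOrthonormalBasis_apply hcard, h0]
    rw [h0, ← norm_ne_zero_iff, he]
    exact one_ne_zero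
  · exact InnerProductSpace.gramSchmidtOrthonormalBasis_inv_triangular hcard f
      (show (1 : Fin 3) < 2 by decide)

lemma dot_spherePt (θ φ : ℝ) (x : Sph 2) :
    dot (spherePt b θ φ) x = Real.cos θ * inner ℝ (b 0) (x : EuclideanSpace ℝ (Fin 3))
      + Real.sin θ * Real.cos φ * inner ℝ (b 1) (x : EuclideanSpace ℝ (Fin 3))
      + Real.sin θ * Real.sin φ * inner ℝ (b 2) (x : EuclideanSpace ℝ (Fin 3)) :=
  inner_spherePt b θ φ x

lemma dot_eq_sum (x y : Sph 2) :
    dot x y = inner ℝ (b 0) (x : EuclideanSpace ℝ (Fin 3)) * inner ℝ (b 0) (y : EuclideanSpace ℝ (Fin 3))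
      + inner ℝ (b 1) (x : EuclideanSpace ℝ (Fin 3)) * inner ℝ (b 1) (y : EuclideanSpace ℝ (Fin 3))
      + inner ℝ (b 2) (x : EuclideanSpace ℝ (Fin 3))
        * inner ℝ (b 2) (y : EuclideanSpace ℝ (Fin 3)) := by
  rw [dot, ← b.sum_inner_mul_inner, Fin.sum_univ_three]
  simp only [real_inner_comm (b _) (x : EuclideanSpace ℝ (Fin 3))]

/-- A frame whose pole is `x` and whose last vector is orthogonal to `μ`. -/
lemma exists_frame_dot (x μ : Sph 2) :
    ∃ b : OrthonormalBasis (Fin 3) ℝ (EuclideanSpace ℝ (Fin 3)), ∃ m₁ : ℝ,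
      m₁ ^ 2 = 1 - dot x μ ^ 2 ∧ ∀ θ φ, dot (spherePt b θ φ) x = Real.cos θ ∧
        dot (spherePt b θ φ) μ = Real.cos θ * dot x μ + Real.sin θ * Real.cos φ * m₁ := by
  obtain ⟨b, h0, h2⟩ := exists_frame (norm_eq_of_mem_sphere x) (μ : EuclideanSpace ℝ (Fin 3))
  have hx0 : inner ℝ (b 0) (x : EuclideanSpace ℝ (Fin 3)) = 1 := by
    rw [← h0, real_inner_self_eq_norm_sq, b.norm_eq_one, one_pow]
  have hx1 : inner ℝ (b 1) (x : EuclideanSpace ℝ (Fin 3)) = 0 := by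
    rw [← h0]; exact b.inner_eq_zero (by decide)
  have hx2 : inner ℝ (b 2) (x : EuclideanSpace ℝ (Fin 3)) = 0 := by
    rw [← h0]; exact b.inner_eq_zero (by decide)
  have hμ0 : inner ℝ (b 0) (μ : EuclideanSpace ℝ (Fin 3)) = dot x μ := by rw [h0, dot]
  refine ⟨b, inner ℝ (b 1) (μ : EuclideanSpace ℝ (Fin 3)), ?_, fun θ φ => ⟨?_, ?_⟩⟩
  · have := dot_eq_sum b μ μ
    rw [dot_self, hμ0, h2] at this
    linarith
  · rw [dot_spherePt, hx0, hx1, hx2]; ring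
  · rw [dot_spherePt, hμ0, h2]; ring

lemma surface_two_dot_eq_null (γ : Sph 2) (t : ℝ) : surface 2 {x | dot γ x = t} = 0 := by
  obtain ⟨b, m₁, -, hb⟩ := exists_frame_dot γ γ
  have hm : MeasurableSet {x | dot γ x = t} :=
    (continuous_dot_right _).measurable (measurableSet_singleton t)
  have : (fun p : ℝ × ℝ => spherePt b p.1 p.2) ⁻¹' {x | dot γ x = t}
      = {θ | Real.cos θ = t} ×ˢ univ := by
    ext p
    simp only [mem_preimage, mem_ofPred_eq, mem_prod, mem_univ, and_true]
    rw [dot_comm, (hb _ _).1]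
  rw [surface_two_eq_map b, Measure.map_apply (continuous_spherePt b).measurable hm, this,
    sphericalMeasure, Measure.prod_prod]
  rw [((withDensity_absolutelyContinuous _ _).trans
    (Measure.absolutelyContinuous_of_le Measure.restrict_le_self))
    ((countable_setOf_cos_eq t).measure_zero volume), zero_mul]

lemma integral_cubic (a₀ a₁ a₂ a₃ t : ℝ) :
    ∫ z in (-1 : ℝ)..t, (a₀ + a₁ * z + a₂ * z ^ 2 + a₃ * z ^ 3)
      = a₀ * (t + 1) + a₁ * (t ^ 2 - 1) / 2 + a₂ * (t ^ 3 + 1) / 3 + a₃ * (t ^ 4 - 1) / 4 := by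
  rw [intervalIntegral.integral_eq_sub_of_hasDerivAt
    (f := fun z => a₀ * z + a₁ * z ^ 2 / 2 + a₂ * z ^ 3 / 3 + a₃ * z ^ 4 / 4)]
  · ring
  · intro z _
    have hi := hasDerivAt_id' z
    refine ((((hi.const_mul a₀).fun_add (((hi.fun_pow 2).const_mul a₁).div_const 2)).fun_add
      (((hi.fun_pow 3).const_mul a₂).div_const 3)).fun_add
      (((hi.fun_pow 4).const_mul a₃).div_const 4)).congr_deriv ?_
    push_cast
    ring
  · exact Continuous.intervalIntegrable (by fun_prop) _ _

/-- This is the Funk–Hecke mechanism in degree at most two. With m = γᵀμ, the averages of xᵀμ and of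
its square over the circle γᵀx = z are mz and (1 - m²)/2 + (3m² - 1)z²/2, which are then integrated
over z from -1 to t. -/
lemma setIntegral_quadratic_dot (γ μ : Sph 2) {t : ℝ} (ht : t ∈ Icc (-1 : ℝ) 1) (c₀ c₁ c₂ : ℝ) :
    ∫ x in {x | dot γ x ≤ t}, (c₀ + c₁ * dot x μ + c₂ * dot x μ ^ 2) ∂(surface 2)
      = 2 * π * (c₀ * (t + 1) + c₁ * dot γ μ * (t ^ 2 - 1) / 2
        + c₂ * ((1 - dot γ μ ^ 2) / 2 * (t + 1) + (3 * dot γ μ ^ 2 - 1) / 2 * (t ^ 3 + 1) / 3)) := by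
  obtain ⟨b, m₁, hm₁, hb⟩ := exists_frame_dot γ μ
  set m := dot γ μ
  have hs : MeasurableSet {x | dot γ x ≤ t} := (continuous_dot_right γ).measurable measurableSet_Iic
  have hd := continuous_dot_left μ
  have hcont : Continuous fun x => c₀ + c₁ * dot x μ + c₂ * dot x μ ^ 2 := by fun_prop
  obtain ⟨C, hC⟩ := exists_abs_le_of_continuous hcont
  rw [← integral_indicator hs, integral_surface_two b (hcont.measurable.indicator hs) (C := C)]
  · have hτ := Real.cos_arccos ht.1 ht.2
    set τ := Real.arccos t with hτ'
    have hτ0 : 0 ≤ τ := Real.arccos_nonneg t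
    have hτπ : τ ≤ π := Real.arccos_le_pi t
    have e : ∀ θ ∈ Ioc 0 π, Real.sin θ * ∫ φ in (-π)..π, {x | dot γ x ≤ t}.indicator
          (fun x => c₀ + c₁ * dot x μ + c₂ * dot x μ ^ 2) (spherePt b θ φ)
        = (Ici τ).indicator (fun θ => Real.sin θ * (2 * π * (c₀ + c₂ * (1 - m ^ 2) / 2
          + c₁ * m * Real.cos θ + c₂ * (3 * m ^ 2 - 1) / 2 * Real.cos θ ^ 2
          + 0 * Real.cos θ ^ 3))) θ := by
      intro θ hθ
      have h3 : Real.cos θ ≤ t ↔ τ ≤ θ := by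
        rw [← hτ]
        exact Real.strictAntiOn_cos.le_iff_ge ⟨hθ.1.le, hθ.2⟩ ⟨hτ0, hτπ⟩
      by_cases h : τ ≤ θ
      · have h4 : ∀ φ, {x | dot γ x ≤ t}.indicator
            (fun x => c₀ + c₁ * dot x μ + c₂ * dot x μ ^ 2) (spherePt b θ φ)
            = (c₀ + c₁ * (Real.cos θ * m) + c₂ * (Real.cos θ * m) ^ 2)
              + (c₁ * Real.sin θ * m₁ + 2 * c₂ * Real.cos θ * m * Real.sin θ * m₁) * Real.cos φ
              + (c₂ * (1 - Real.cos θ ^ 2) * (1 - m ^ 2)) * Real.cos φ ^ 2 + 0 * Real.cos φ ^ 3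
              + 0 * Real.cos φ ^ 4 + Real.sin φ * (0 + 0 * Real.cos φ + 0 * Real.cos φ ^ 2
                + 0 * Real.cos φ ^ 3) := fun φ => by
          have : spherePt b θ φ ∈ {x | dot γ x ≤ t} := by
            rw [mem_ofPred_eq, dot_comm, (hb _ _).1, h3]; exact h
          rw [indicator_of_mem this, (hb _ _).2, ← hm₁, ← Real.sin_sq]
          ring
        rw [indicator_of_mem (mem_Ici.2 h)]
        simp_rw [h4, integral_trig_polynomial]
        ring
      · have h4 : ∀ φ, {x | dot γ x ≤ t}.indicator
            (fun x => c₀ + c₁ * dot x μ + c₂ * dot x μ ^ 2) (spherePt b θ φ) = 0 := fun φ => by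
          refine indicator_of_notMem ?_ _
          rw [mem_ofPred_eq, dot_comm, (hb _ _).1, h3]; exact h
        rw [indicator_of_notMem (by simpa using h)]
        simp_rw [h4]
        simp
    rw [intervalIntegral.integral_of_le Real.pi_pos.le, setIntegral_congr_fun measurableSet_Ioc e,
      integral_indicator measurableSet_Ici, Measure.restrict_restrict measurableSet_Ici,
      Measure.restrict_congr_set ((Ioi_ae_eq_Ici (μ := volume)).symm.inter (ae_eq_refl (Ioc 0 π))),
      inter_comm, Ioc_inter_Ioi, max_eq_right hτ0, ← intervalIntegral.integral_of_le hτπ,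
      integral_sin_mul_comp_cos (P := fun z => 2 * π * (c₀ + c₂ * (1 - m ^ 2) / 2
          + c₁ * m * z + c₂ * (3 * m ^ 2 - 1) / 2 * z ^ 2 + 0 * z ^ 3)) (by fun_prop), hτ,
      intervalIntegral.integral_const_mul, integral_cubic]
    ring
  · intro x
    refine le_trans ?_ (hC x)
    rw [← Real.norm_eq_abs, ← Real.norm_eq_abs]
    exact norm_indicator_le_norm_self _ _

/-- Degree ten is reached by the square of the order-two distribution function, which has degree
five in z in the frame with pole x. -/
lemma integral_even_odd_polynomial (a₀ a₁ a₂ a₃ a₄ a₅ a₆ a₇ a₈ a₉ a₁₀ : ℝ) :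
    ∫ z in (-1 : ℝ)..1, (a₀ + a₁ * z + a₂ * z ^ 2 + a₃ * z ^ 3 + a₄ * z ^ 4 + a₅ * z ^ 5
      + a₆ * z ^ 6 + a₇ * z ^ 7 + a₈ * z ^ 8 + a₉ * z ^ 9 + a₁₀ * z ^ 10)
      = 2 * (a₀ + a₂ / 3 + a₄ / 5 + a₆ / 7 + a₈ / 9 + a₁₀ / 11) := by
  rw [intervalIntegral.integral_eq_sub_of_hasDerivAt
    (f := fun z => a₀ * z + a₁ * z ^ 2 / 2 + a₂ * z ^ 3 / 3 + a₃ * z ^ 4 / 4 + a₄ * z ^ 5 / 5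
      + a₅ * z ^ 6 / 6 + a₆ * z ^ 7 / 7 + a₇ * z ^ 8 / 8 + a₈ * z ^ 9 / 9 + a₉ * z ^ 10 / 10
      + a₁₀ * z ^ 11 / 11)]
  · ring
  · intro z _
    have hi := hasDerivAt_id' z
    have hp : ∀ (a : ℝ) (n : ℕ), HasDerivAt (fun z : ℝ => a * z ^ (n + 1) / (n + 1 : ℕ))
        (a * z ^ n) z := fun a n => by
      refine (((hi.fun_pow (n + 1)).const_mul a).div_const _).congr_deriv ?_
      have : ((n + 1 : ℕ) : ℝ) ≠ 0 := by positivity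
      field_simp
      simp
    have h := (((((((((((hi.const_mul a₀).fun_add (hp a₁ 1)).fun_add (hp a₂ 2)).fun_add
      (hp a₃ 3)).fun_add (hp a₄ 4)).fun_add (hp a₅ 5)).fun_add (hp a₆ 6)).fun_add
      (hp a₇ 7)).fun_add (hp a₈ 8)).fun_add (hp a₉ 9)).fun_add (hp a₁₀ 10))
    norm_num at h
    exact h.congr_deriv (by ring)
  · exact Continuous.intervalIntegrable (by fun_prop) _ _

lemma integral_abs_mul_even_polynomial (a₀ a₂ a₄ : ℝ) :
    ∫ z in (-1 : ℝ)..1, |z| * (a₀ + a₂ * z ^ 2 + a₄ * z ^ 4) = a₀ + a₂ / 2 + a₄ / 3 := by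
  have hint : ∀ u v, IntervalIntegrable (fun z : ℝ => |z| * (a₀ + a₂ * z ^ 2 + a₄ * z ^ 4))
      volume u v := fun u v => Continuous.intervalIntegrable (by fun_prop) _ _
  have h1 : ∫ z in (0 : ℝ)..1, |z| * (a₀ + a₂ * z ^ 2 + a₄ * z ^ 4)
      = (a₀ + a₂ / 2 + a₄ / 3) / 2 := by
    have e : ∀ z ∈ uIcc (0 : ℝ) 1, |z| * (a₀ + a₂ * z ^ 2 + a₄ * z ^ 4)
        = a₀ * z + a₂ * z ^ 3 + a₄ * z ^ 5 := fun z hz => by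
      rw [uIcc_of_le zero_le_one] at hz
      rw [abs_of_nonneg hz.1]; ring
    rw [intervalIntegral.integral_congr e, intervalIntegral.integral_eq_sub_of_hasDerivAt
      (f := fun z => a₀ * z ^ 2 / 2 + a₂ * z ^ 4 / 4 + a₄ * z ^ 6 / 6)]
    · ring
    · intro z _
      have hi := hasDerivAt_id' z
      refine (((((hi.fun_pow 2).const_mul a₀).div_const 2).fun_add
        (((hi.fun_pow 4).const_mul a₂).div_const 4)).fun_add
        (((hi.fun_pow 6).const_mul a₄).div_const 6)).congr_deriv ?_
      push_cast
      ring
    · exact Continuous.intervalIntegrable (by fun_prop) _ _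
  have h2 : ∫ z in (-1 : ℝ)..0, |z| * (a₀ + a₂ * z ^ 2 + a₄ * z ^ 4)
      = ∫ z in (0 : ℝ)..1, |z| * (a₀ + a₂ * z ^ 2 + a₄ * z ^ 4) := by
    have := intervalIntegral.integral_comp_neg (a := 0) (b := 1)
      fun z : ℝ => |z| * (a₀ + a₂ * z ^ 2 + a₄ * z ^ 4)
    simp only [abs_neg, neg_zero] at this
    rw [← this]
    exact intervalIntegral.integral_congr fun z _ => by ring
  rw [← intervalIntegral.integral_add_adjacent_intervals (hint (-1) 0) (hint 0 1), h2, h1]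
  ring

end SphereIntegral

/-! ### The cardioid distributions of orders one and two on the 2-sphere. -/

section SphereCardioid

lemma integral_unif_two (f : Sph 2 → ℝ) :
    ∫ γ, f γ ∂(unif 2) = 1 / (4 * π) * ∫ γ, f γ ∂(surface 2) := by
  rw [integral_unif, area_two]

lemma sphPolyNormalized_two_one : sphPolyNormalized 2 1 = fun x => x := by
  ext x
  norm_num [sphPolyNormalized, sphPoly, gegenbauer]

lemma sphPolyNormalized_two_two : sphPolyNormalized 2 2 = fun x => (3 * x ^ 2 - 1) / 2 := by
  ext x
  norm_num [sphPolyNormalized, sphPoly, gegenbauer]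
  ring

lemma continuous_sphPolyNormalized_two_one : Continuous (sphPolyNormalized 2 1) := by
  rw [sphPolyNormalized_two_one]; fun_prop

lemma continuous_sphPolyNormalized_two_two : Continuous (sphPolyNormalized 2 2) := by
  rw [sphPolyNormalized_two_two]; fun_prop

variable {ρ : ℝ}

lemma one_add_mul_sphPolyNormalized_two_one_nonneg (hρ : ρ ∈ Icc (-1 : ℝ) 1) (μ x : Sph 2) :
    0 ≤ 1 + ρ * sphPolyNormalized 2 1 (dot x μ) := by
  rw [sphPolyNormalized_two_one]
  exact one_add_mul_nonneg_of_abs_le_one hρ (abs_le.2 (dot_mem_Icc x μ))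

lemma one_add_mul_sphPolyNormalized_two_two_nonneg (hρ : ρ ∈ Icc (-1 : ℝ) 1) (μ x : Sph 2) :
    0 ≤ 1 + ρ * sphPolyNormalized 2 2 (dot x μ) := by
  rw [sphPolyNormalized_two_two]
  have h := dot_mem_Icc x μ
  exact one_add_mul_nonneg_of_abs_le_one hρ (abs_le.2 ⟨by nlinarith [sq_nonneg (dot x μ)],
    by nlinarith [h.1, h.2]⟩)

lemma integral_quadratic_dot (μ : Sph 2) (c₀ c₁ c₂ : ℝ) :
    ∫ x, (c₀ + c₁ * dot x μ + c₂ * dot x μ ^ 2) ∂(surface 2) = 4 * π * (c₀ + c₂ / 3) := by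
  have h := setIntegral_quadratic_dot μ μ (t := 1) (by norm_num) c₀ c₁ c₂
  have hu : {x | dot μ x ≤ 1} = univ := eq_univ_of_forall fun x => (dot_mem_Icc μ x).2
  rw [hu, Measure.restrict_univ, dot_self] at h
  rw [h]
  ring

lemma integral_sphPolyNormalized_two_one (μ : Sph 2) :
    ∫ x, sphPolyNormalized 2 1 (dot x μ) ∂(surface 2) = 0 := by
  have h := integral_quadratic_dot μ 0 1 0
  rw [sphPolyNormalized_two_one]
  simpa using h

lemma integral_sphPolyNormalized_two_two (μ : Sph 2) :
    ∫ x, sphPolyNormalized 2 2 (dot x μ) ∂(surface 2) = 0 := by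
  have h := integral_quadratic_dot μ (-1 / 2) 0 (3 / 2)
  rw [sphPolyNormalized_two_two]
  norm_num at h
  rw [← h]
  congr 1
  ext x
  ring

/-- The distribution function of the projection on `γ` of the cardioid distribution of order one
on the two-dimensional sphere. -/
def sphereCdf₁ (μ : Sph 2) (ρ : ℝ) (γ : Sph 2) (t : ℝ) : ℝ :=
  (1 + t) / 2 + ρ * dot γ μ * ((t ^ 2 - 1) / 4)

/-- The distribution function of the projection on `γ` of the cardioid distribution of order two
on the two-dimensional sphere. -/
def sphereCdf₂ (μ : Sph 2) (ρ : ℝ) (γ : Sph 2) (t : ℝ) : ℝ :=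
  (1 + t) / 2 + ρ * ((3 * dot γ μ ^ 2 - 1) / 2) * ((t ^ 3 - t) / 4)

lemma continuous_sphereCdf₁ (μ : Sph 2) (ρ : ℝ) :
    Continuous fun p : Sph 2 × ℝ => sphereCdf₁ μ ρ p.1 p.2 := by
  have h2 : Continuous fun p : Sph 2 × ℝ => dot p.1 μ :=
    (continuous_dot_left μ).comp continuous_fst
  unfold sphereCdf₁
  fun_prop

lemma continuous_sphereCdf₂ (μ : Sph 2) (ρ : ℝ) :
    Continuous fun p : Sph 2 × ℝ => sphereCdf₂ μ ρ p.1 p.2 := by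
  have h2 : Continuous fun p : Sph 2 × ℝ => dot p.1 μ :=
    (continuous_dot_left μ).comp continuous_fst
  unfold sphereCdf₂
  fun_prop

lemma projCdf_two_one_eq (hρ : ρ ∈ Icc (-1 : ℝ) 1) (μ γ : Sph 2) {t : ℝ}
    (ht : t ∈ Icc (-1 : ℝ) 1) : projCdf 2 1 μ ρ γ t = sphereCdf₁ μ ρ γ t := by
  have h := setIntegral_quadratic_dot γ μ ht 1 ρ 0
  simp only [zero_mul, add_zero] at h
  rw [projCdf_eq_setIntegral continuous_sphPolyNormalized_two_one
    (one_add_mul_sphPolyNormalized_two_one_nonneg hρ μ) (integral_sphPolyNormalized_two_one μ),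
    area_two, sphPolyNormalized_two_one, h, sphereCdf₁]
  field_simp
  ring

lemma projCdf_two_two_eq (hρ : ρ ∈ Icc (-1 : ℝ) 1) (μ γ : Sph 2) {t : ℝ}
    (ht : t ∈ Icc (-1 : ℝ) 1) : projCdf 2 2 μ ρ γ t = sphereCdf₂ μ ρ γ t := by
  have h := setIntegral_quadratic_dot γ μ ht (1 - ρ / 2) 0 (3 * ρ / 2)
  have e : (fun x : Sph 2 => 1 + ρ * ((3 * dot x μ ^ 2 - 1) / 2))
      = fun x => 1 - ρ / 2 + 0 * dot x μ + 3 * ρ / 2 * dot x μ ^ 2 := by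
    ext x; ring
  rw [projCdf_eq_setIntegral continuous_sphPolyNormalized_two_two
    (one_add_mul_sphPolyNormalized_two_two_nonneg hρ μ) (integral_sphPolyNormalized_two_two μ),
    area_two, sphPolyNormalized_two_two, e, h, sphereCdf₂]
  field_simp
  ring

/-- With pole x the azimuthal mean is 1/2 plus an odd polynomial in z, and the odd part integrates
to zero. The same holds for order two. -/
lemma integral_sphereCdf₁ (μ x : Sph 2) :
    ∫ γ, sphereCdf₁ μ ρ γ (dot γ x) ∂(unif 2) = 1 / 2 := by
  obtain ⟨b, m₁, hm₁, hb⟩ := exists_frame_dot x μ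
  have hcont : Continuous fun γ => sphereCdf₁ μ ρ γ (dot γ x) :=
    (continuous_sphereCdf₁ μ ρ).comp (continuous_id.prodMk (continuous_dot_left x))
  set m := dot x μ
  rw [integral_unif_two, integral_surface_two_of_trig b hcont
    (fun θ => (1 + Real.cos θ) / 2 + ρ * (Real.cos θ * m) * ((Real.cos θ ^ 2 - 1) / 4))
    (fun θ => ρ * (Real.sin θ * m₁) * ((Real.cos θ ^ 2 - 1) / 4)) 0 0 0 0 0 0 0
    (fun θ φ => by
      rw [sphereCdf₁, (hb θ φ).1, (hb θ φ).2]
      simp only [Pi.zero_apply]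
      ring)
    (P := fun z => 1 / 2 + (1 / 2 - ρ * m / 4) * z + 0 * z ^ 2 + (ρ * m / 4) * z ^ 3 + 0 * z ^ 4
      + 0 * z ^ 5 + 0 * z ^ 6 + 0 * z ^ 7 + 0 * z ^ 8 + 0 * z ^ 9 + 0 * z ^ 10) (by fun_prop)
    (fun θ => by simp only [Pi.zero_apply]; ring), integral_even_odd_polynomial]
  field_simp
  ring

lemma integral_sphereCdf₂ (μ x : Sph 2) :
    ∫ γ, sphereCdf₂ μ ρ γ (dot γ x) ∂(unif 2) = 1 / 2 := by
  obtain ⟨b, m₁, hm₁, hb⟩ := exists_frame_dot x μ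
  have hcont : Continuous fun γ => sphereCdf₂ μ ρ γ (dot γ x) :=
    (continuous_sphereCdf₂ μ ρ).comp (continuous_id.prodMk (continuous_dot_left x))
  set m := dot x μ
  rw [integral_unif_two, integral_surface_two_of_trig b hcont
    (fun θ => (1 + Real.cos θ) / 2
      + ρ * ((3 * (Real.cos θ * m) ^ 2 - 1) / 2) * ((Real.cos θ ^ 3 - Real.cos θ) / 4))
    (fun θ => ρ * (3 * Real.cos θ * m * Real.sin θ * m₁) * ((Real.cos θ ^ 3 - Real.cos θ) / 4))
    (fun θ => ρ * (3 * (1 - Real.cos θ ^ 2) * (1 - m ^ 2) / 2)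
      * ((Real.cos θ ^ 3 - Real.cos θ) / 4)) 0 0 0 0 0 0
    (fun θ φ => by
      rw [sphereCdf₂, (hb θ φ).1, (hb θ φ).2, ← hm₁, ← Real.sin_sq]
      simp only [Pi.zero_apply]
      ring)
    (P := fun z => 1 / 2 + (1 / 2 + (-1 + 3 * m ^ 2) * ρ / 16) * z + 0 * z ^ 2
      + ρ * (1 - 3 * m ^ 2) / 4 * z ^ 3 + 0 * z ^ 4
      + ρ * (-3 + 9 * m ^ 2) / 16 * z ^ 5 + 0 * z ^ 6 + 0 * z ^ 7 + 0 * z ^ 8 + 0 * z ^ 9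
      + 0 * z ^ 10) (by fun_prop)
    (fun θ => by simp only [Pi.zero_apply]; ring), integral_even_odd_polynomial]
  field_simp
  ring

lemma integral_sphereCdf₁_sq (μ x : Sph 2) :
    ∫ γ, sphereCdf₁ μ ρ γ (dot γ x) ^ 2 ∂(unif 2) = 1 / 3 - phiSphere₁ ρ (dot x μ) := by
  obtain ⟨b, m₁, hm₁, hb⟩ := exists_frame_dot x μ
  have hcont : Continuous fun γ => sphereCdf₁ μ ρ γ (dot γ x) ^ 2 :=
    ((continuous_sphereCdf₁ μ ρ).comp (continuous_id.prodMk (continuous_dot_left x))).pow 2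
  set m := dot x μ
  rw [integral_unif_two, integral_surface_two_of_trig b hcont
    (fun θ => ((1 + Real.cos θ) / 2 + ρ * (Real.cos θ * m) * ((Real.cos θ ^ 2 - 1) / 4)) ^ 2)
    (fun θ => 2 * ((1 + Real.cos θ) / 2 + ρ * (Real.cos θ * m) * ((Real.cos θ ^ 2 - 1) / 4))
      * (ρ * (Real.sin θ * m₁) * ((Real.cos θ ^ 2 - 1) / 4)))
    (fun θ => ρ ^ 2 * ((1 - Real.cos θ ^ 2) * (1 - m ^ 2)) * ((Real.cos θ ^ 2 - 1) / 4) ^ 2)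
    0 0 0 0 0 0
    (fun θ φ => by
      rw [sphereCdf₁, (hb θ φ).1, (hb θ φ).2, ← hm₁, ← Real.sin_sq]
      simp only [Pi.zero_apply]
      ring)
    (P := fun z => (1 / 4 + ρ ^ 2 * (1 - m ^ 2) / 32) + (1 / 2 - ρ * m / 4) * z
      + (1 / 4 - ρ * m / 4 + ρ ^ 2 * m ^ 2 / 16 - 3 * ρ ^ 2 * (1 - m ^ 2) / 32) * z ^ 2
      + (ρ * m / 4) * z ^ 3
      + (ρ * m / 4 - ρ ^ 2 * m ^ 2 / 8 + 3 * ρ ^ 2 * (1 - m ^ 2) / 32) * z ^ 4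
      + 0 * z ^ 5 + (ρ ^ 2 * m ^ 2 / 16 - ρ ^ 2 * (1 - m ^ 2) / 32) * z ^ 6 + 0 * z ^ 7 + 0 * z ^ 8
      + 0 * z ^ 9 + 0 * z ^ 10) (by fun_prop)
    (fun θ => by simp only [Pi.zero_apply]; ring), integral_even_odd_polynomial, phiSphere₁]
  field_simp
  ring

lemma integral_sphereCdf₂_sq (μ x : Sph 2) :
    ∫ γ, sphereCdf₂ μ ρ γ (dot γ x) ^ 2 ∂(unif 2) = 1 / 3 - phiSphere₂ ρ (dot x μ) := by
  obtain ⟨b, m₁, hm₁, hb⟩ := exists_frame_dot x μ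
  have hcont : Continuous fun γ => sphereCdf₂ μ ρ γ (dot γ x) ^ 2 :=
    ((continuous_sphereCdf₂ μ ρ).comp (continuous_id.prodMk (continuous_dot_left x))).pow 2
  set m := dot x μ
  -- These are the coefficients of the distribution function in powers of cos φ. The factor sin θ ·
  -- m₁ is left out of `v₁`, so that after squaring it becomes (1 - cos²θ)(1 - m²).
  let u₀ : ℝ → ℝ := fun θ => (1 + Real.cos θ) / 2
      + ρ * ((3 * (Real.cos θ * m) ^ 2 - 1) / 2) * ((Real.cos θ ^ 3 - Real.cos θ) / 4)
  let v₁ : ℝ → ℝ := fun θ => ρ * (3 * Real.cos θ * m) * ((Real.cos θ ^ 3 - Real.cos θ) / 4)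
  let u₂ : ℝ → ℝ := fun θ => ρ * (3 * (1 - Real.cos θ ^ 2) * (1 - m ^ 2) / 2)
      * ((Real.cos θ ^ 3 - Real.cos θ) / 4)
  rw [integral_unif_two, integral_surface_two_of_trig b hcont
    (fun θ => u₀ θ ^ 2) (fun θ => 2 * u₀ θ * (v₁ θ * Real.sin θ * m₁))
    (fun θ => v₁ θ ^ 2 * ((1 - Real.cos θ ^ 2) * (1 - m ^ 2)) + 2 * u₀ θ * u₂ θ)
    (fun θ => 2 * u₂ θ * (v₁ θ * Real.sin θ * m₁)) (fun θ => u₂ θ ^ 2) 0 0 0 0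
    (fun θ φ => by
      have h : sphereCdf₂ μ ρ (spherePt b θ φ) (dot (spherePt b θ φ) x)
          = u₀ θ + v₁ θ * Real.sin θ * m₁ * Real.cos φ + u₂ θ * Real.cos φ ^ 2 := by
        simp only [u₀, v₁, u₂]
        rw [sphereCdf₂, (hb θ φ).1, (hb θ φ).2, ← hm₁, ← Real.sin_sq]
        ring
      rw [h, ← hm₁, ← Real.sin_sq]
      simp only [Pi.zero_apply]
      ring)
    (P := fun z => 1 / 4 + (1 / 2 - ρ / 16 + 3 / 16 * ρ * m ^ 2) * z
      + (1 / 4 - 1 / 16 * ρ + 3 / 16 * ρ * m ^ 2 + 11 / 512 * ρ ^ 2 - 15 / 256 * ρ ^ 2 * m ^ 2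
        + 27 / 512 * ρ ^ 2 * m ^ 4) * z ^ 2
      + (1 / 4 * ρ - 3 / 4 * ρ * m ^ 2) * z ^ 3
      + (1 / 4 * ρ - 3 / 4 * ρ * m ^ 2 - 13 / 128 * ρ ^ 2 + 39 / 64 * ρ ^ 2 * m ^ 2
        - 81 / 128 * ρ ^ 2 * m ^ 4) * z ^ 4
      + (-3 / 16 * ρ + 9 / 16 * ρ * m ^ 2) * z ^ 5
      + (-3 / 16 * ρ + 9 / 16 * ρ * m ^ 2 + 49 / 256 * ρ ^ 2 - 201 / 128 * ρ ^ 2 * m ^ 2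
        + 441 / 256 * ρ ^ 2 * m ^ 4) * z ^ 6
      + 0 * z ^ 7
      + (-21 / 128 * ρ ^ 2 + 99 / 64 * ρ ^ 2 * m ^ 2 - 225 / 128 * ρ ^ 2 * m ^ 4) * z ^ 8
      + 0 * z ^ 9
      + (27 / 512 * ρ ^ 2 - 135 / 256 * ρ ^ 2 * m ^ 2 + 315 / 512 * ρ ^ 2 * m ^ 4) * z ^ 10)
      (by fun_prop)
    (fun θ => by simp only [u₀, v₁, u₂]; ring), integral_even_odd_polynomial,
    phiSphere₂]
  field_simp
  ring

/-- A frame whose pole is the direction of `x - y` and whose last vector is orthogonal to `μ`. -/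
lemma exists_frame_sub {x y : Sph 2} (hxy : x ≠ y) (μ : Sph 2) :
    ∃ b : OrthonormalBasis (Fin 3) ℝ (EuclideanSpace ℝ (Fin 3)), ∃ h p q m₀ m₁ : ℝ,
      0 < h ∧ m₀ ^ 2 + m₁ ^ 2 = 1 ∧ h ^ 2 + p ^ 2 + q ^ 2 = 1 ∧ dot x y = 1 - 2 * h ^ 2 ∧
      dot x μ = h * m₀ + p * m₁ ∧ dot y μ = -h * m₀ + p * m₁ ∧ ∀ θ φ,
        dot (spherePt b θ φ) x
          = Real.cos θ * h + Real.sin θ * (p * Real.cos φ + q * Real.sin φ) ∧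
        dot (spherePt b θ φ) y
          = -Real.cos θ * h + Real.sin θ * (p * Real.cos φ + q * Real.sin φ) ∧
        dot (spherePt b θ φ) μ = Real.cos θ * m₀ + Real.sin θ * Real.cos φ * m₁ := by
  set w : EuclideanSpace ℝ (Fin 3) := (x : EuclideanSpace ℝ (Fin 3)) - y with hw
  have hw0 : w ≠ 0 := sub_ne_zero.2 fun h => hxy (Subtype.ext h)
  have hwn : 0 < ‖w‖ := norm_pos_iff.2 hw0
  have he : ‖(‖w‖⁻¹ : ℝ) • w‖ = 1 := by
    rw [norm_smul, norm_inv, norm_norm, inv_mul_cancel₀ hwn.ne']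
  obtain ⟨b, h0, h2⟩ := exists_frame he (μ : EuclideanSpace ℝ (Fin 3))
  have hwb : w = ‖w‖ • b 0 := by
    rw [h0, smul_smul, mul_inv_cancel₀ hwn.ne', one_smul]
  -- As x - y is a multiple of `b 0`, the points share their other two coordinates; unit norms then
  -- force opposite first coordinates ±h, where 2h is the length of x - y.
  have hdiff : ∀ i, inner ℝ (b i) (x : EuclideanSpace ℝ (Fin 3))
      - inner ℝ (b i) (y : EuclideanSpace ℝ (Fin 3)) = ‖w‖ * inner ℝ (b i) (b 0) := fun i => by
    rw [← inner_sub_right, ← hw, hwb, inner_smul_right, ← hwb]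
  have d0 := hdiff 0
  have d1 := hdiff 1
  have d2 := hdiff 2
  rw [real_inner_self_eq_norm_sq, b.norm_eq_one] at d0
  rw [b.inner_eq_zero (by decide)] at d1
  rw [b.inner_eq_zero (by decide)] at d2
  have hxx := dot_eq_sum b x x
  have hyy := dot_eq_sum b y y
  have hxy' := dot_eq_sum b x y
  have hmm := dot_eq_sum b μ μ
  have hxm := dot_eq_sum b x μ
  have hym := dot_eq_sum b y μ
  rw [dot_self] at hxx hyy hmm
  have hsp := fun θ φ => dot_spherePt b θ φ x
  have hsq := fun θ φ => dot_spherePt b θ φ y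
  have hsm := fun θ φ => dot_spherePt b θ φ μ
  rw [h2] at hmm hxm hym
  simp only [h2] at hsm
  generalize inner ℝ (b 0) (x : EuclideanSpace ℝ (Fin 3)) = x₀ at *
  generalize inner ℝ (b 1) (x : EuclideanSpace ℝ (Fin 3)) = x₁ at *
  generalize inner ℝ (b 2) (x : EuclideanSpace ℝ (Fin 3)) = x₂ at *
  generalize inner ℝ (b 0) (y : EuclideanSpace ℝ (Fin 3)) = y₀ at *
  generalize inner ℝ (b 1) (y : EuclideanSpace ℝ (Fin 3)) = y₁ at *
  generalize inner ℝ (b 2) (y : EuclideanSpace ℝ (Fin 3)) = y₂ at *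
  generalize inner ℝ (b 0) (μ : EuclideanSpace ℝ (Fin 3)) = m₀ at *
  generalize inner ℝ (b 1) (μ : EuclideanSpace ℝ (Fin 3)) = m₁ at *
  have e1 : y₁ = x₁ := by linarith
  have e2 : y₂ = x₂ := by linarith
  subst e1 e2
  have e0 : y₀ = -x₀ := by
    have h3 : (x₀ - y₀) * (x₀ + y₀) = 0 := by linarith
    rcases mul_eq_zero.1 h3 with h4 | h4
    · linarith
    · linarith
  subst e0
  refine ⟨b, x₀, y₁, y₂, m₀, m₁, by linarith, by linarith, by linarith, by linarith,
    hxm.trans (by ring), hym.trans (by ring), fun θ φ => ⟨(hsp θ φ).trans (by ring), (hsq θ φ).trans (by ring),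
      (hsm θ φ).trans (by ring)⟩⟩

lemma psiCvM₂_arccos {t : ℝ} (ht : t ∈ Icc (-1 : ℝ) 1) :
    psiCvM₂ (Real.arccos t) = 1 / 2 - 1 / 4 * √((1 - t) / 2) := by
  rw [psiCvM₂, Real.sin_half_eq_sqrt (Real.arccos_nonneg t)
    (by linarith [Real.arccos_le_pi t, Real.pi_pos]), Real.cos_arccos ht.1 ht.2]

lemma sqrt_one_sub_div_two {h t : ℝ} (hh : 0 ≤ h) (ht : t = 1 - 2 * h ^ 2) :
    √((1 - t) / 2) = h := by
  rw [ht, show (1 - (1 - 2 * h ^ 2)) / 2 = h ^ 2 by ring, Real.sqrt_sq hh]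

/-- For any F, the value at the maximum is the average of F(a) and F(a') plus half of sgn(a -
a')(F(a) - F(a')). A polynomial difference is divisible by a - a', which leaves |a - a'| times a
polynomial. -/
lemma sphereCdf₁_max (μ γ : Sph 2) (a a' : ℝ) :
    sphereCdf₁ μ ρ γ (max a a') = sphereCdf₁ μ ρ γ a / 2 + sphereCdf₁ μ ρ γ a' / 2
      + |a - a'| / 4 * (1 + ρ * dot γ μ * ((a + a') / 2)) := by
  unfold sphereCdf₁
  rcases le_total a a' with h | h
  · rw [max_eq_right h, abs_of_nonpos (by linarith)]; ring
  · rw [max_eq_left h, abs_of_nonneg (by linarith)]; ring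

lemma sphereCdf₂_max (μ γ : Sph 2) (a a' : ℝ) :
    sphereCdf₂ μ ρ γ (max a a') = sphereCdf₂ μ ρ γ a / 2 + sphereCdf₂ μ ρ γ a' / 2
      + |a - a'| / 4 * (1 + ρ * ((3 * dot γ μ ^ 2 - 1) / 2)
        * ((a ^ 2 + a * a' + a' ^ 2 - 1) / 2)) := by
  unfold sphereCdf₂
  rcases le_total a a' with h | h
  · rw [max_eq_right h, abs_of_nonpos (by linarith)]; ring
  · rw [max_eq_left h, abs_of_nonneg (by linarith)]; ring

lemma abs_frame_sub {h : ℝ} (hh : 0 ≤ h) (z w : ℝ) :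
    |z * h + w - (-z * h + w)| = 2 * h * |z| := by
  rw [show z * h + w - (-z * h + w) = 2 * h * z by ring, abs_mul, abs_of_nonneg (by positivity)]

/-- The two averaged terms contribute 1/2 in total. In the frame with pole along x - y the
correction is |z| times a polynomial, and h equals the square root in the kernel. -/
lemma integral_sphereCdf₁_max (μ x y : Sph 2) :
    ∫ γ, sphereCdf₁ μ ρ γ (max (dot γ x) (dot γ y)) ∂(unif 2)
      = 1 - psiSphere₁ ρ (dot x μ) (dot y μ) (dot x y) := by
  have c1 : ∀ x, Continuous fun γ => sphereCdf₁ μ ρ γ (dot γ x) / 2 := fun x =>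
    ((continuous_sphereCdf₁ μ ρ).comp
      (continuous_id.prodMk (continuous_dot_left x))).div_const 2
  have c2 : Continuous fun γ => |dot γ x - dot γ y| / 4
      * (1 + ρ * dot γ μ * ((dot γ x + dot γ y) / 2)) := by
    have := continuous_dot_left x
    have := continuous_dot_left y
    have := continuous_dot_left μ
    fun_prop
  have c3 : Continuous fun γ => sphereCdf₁ μ ρ γ (dot γ x) / 2 + sphereCdf₁ μ ρ γ (dot γ y) / 2 :=
    (c1 x).add (c1 y)
  simp_rw [sphereCdf₁_max]
  rw [integral_add (integrable_of_continuous c3) (integrable_of_continuous c2),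
    integral_add (integrable_of_continuous (c1 x)) (integrable_of_continuous (c1 y)),
    integral_div, integral_div, integral_sphereCdf₁, integral_sphereCdf₁, psiSphere₁,
    psiCvM₂_arccos (dot_mem_Icc x y)]
  rcases eq_or_ne x y with rfl | hxy
  · simp [dot_self]
    norm_num
  obtain ⟨b, h, p, q, m₀, m₁, hh, hm, hpq, ht, hx, hy, hb⟩ := exists_frame_sub hxy μ
  rw [sqrt_one_sub_div_two hh.le ht, hx, hy, integral_unif_two,
    integral_surface_two_of_trig b c2
    (fun θ => |Real.cos θ| * (h / 2))
    (fun θ => |Real.cos θ| * (h / 2) * (ρ * Real.cos θ * m₀ * Real.sin θ * p))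
    (fun θ => |Real.cos θ| * (h / 2) * (ρ * (1 - Real.cos θ ^ 2) * m₁ * p)) 0 0
    (fun θ => |Real.cos θ| * (h / 2) * (ρ * Real.cos θ * m₀ * Real.sin θ * q))
    (fun θ => |Real.cos θ| * (h / 2) * (ρ * (1 - Real.cos θ ^ 2) * m₁ * q)) 0 0
    (fun θ φ => by
      obtain ⟨h1, h2, h3⟩ := hb θ φ
      rw [h1, h2, h3, abs_frame_sub hh.le, ← Real.sin_sq]
      simp only [Pi.zero_apply]
      ring)
    (P := fun z => |z| * (h / 2 * (1 + ρ * m₁ * p / 2) + (-(h * ρ * m₁ * p) / 4) * z ^ 2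
      + 0 * z ^ 4)) (by fun_prop)
    (fun θ => by simp only [Pi.zero_apply]; ring), integral_abs_mul_even_polynomial]
  field_simp
  ring

lemma integral_sphereCdf₂_max (μ x y : Sph 2) :
    ∫ γ, sphereCdf₂ μ ρ γ (max (dot γ x) (dot γ y)) ∂(unif 2)
      = 1 - psiSphere₂ ρ (dot x μ) (dot y μ) (dot x y) := by
  have c1 : ∀ x, Continuous fun γ => sphereCdf₂ μ ρ γ (dot γ x) / 2 := fun x =>
    ((continuous_sphereCdf₂ μ ρ).comp
      (continuous_id.prodMk (continuous_dot_left x))).div_const 2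
  have c2 : Continuous fun γ => |dot γ x - dot γ y| / 4
      * (1 + ρ * ((3 * dot γ μ ^ 2 - 1) / 2)
        * ((dot γ x ^ 2 + dot γ x * dot γ y + dot γ y ^ 2 - 1) / 2)) := by
    have := continuous_dot_left x
    have := continuous_dot_left y
    have := continuous_dot_left μ
    fun_prop
  have c3 : Continuous fun γ => sphereCdf₂ μ ρ γ (dot γ x) / 2 + sphereCdf₂ μ ρ γ (dot γ y) / 2 :=
    (c1 x).add (c1 y)
  simp_rw [sphereCdf₂_max]
  rw [integral_add (integrable_of_continuous c3) (integrable_of_continuous c2),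
    integral_add (integrable_of_continuous (c1 x)) (integrable_of_continuous (c1 y)),
    integral_div, integral_div, integral_sphereCdf₂, integral_sphereCdf₂, psiSphere₂,
    psiCvM₂_arccos (dot_mem_Icc x y)]
  -- No frame exists when x = y, but the correction then vanishes, as does the square root in front
  -- of the quotients.
  rcases eq_or_ne x y with rfl | hxy
  · simp [dot_self]
    norm_num
  obtain ⟨b, h, p, q, m₀, m₁, hh, hm, hpq, ht, hx, hy, hb⟩ := exists_frame_sub hxy μ
  -- `K` is |γᵀx - γᵀy|/4. The α's expand 3(γᵀμ)² - 1 in powers of cos φ. The β's expand a² + aa' +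
  -- a'² - 1 = h² cos²θ + 3w² - 1, with w the common part of both projections; `β₁` multiplies sin φ
  -- cos φ, and sin²φ has been replaced by 1 - cos²φ.
  let K : ℝ → ℝ := fun θ => |Real.cos θ| * (h / 2)
  let α₀ : ℝ → ℝ := fun θ => 3 * Real.cos θ ^ 2 * m₀ ^ 2 - 1
  let α₁ : ℝ → ℝ := fun θ => 6 * Real.cos θ * m₀ * Real.sin θ * m₁
  let α₂ : ℝ → ℝ := fun θ => 3 * (1 - Real.cos θ ^ 2) * m₁ ^ 2
  let β₀ : ℝ → ℝ := fun θ => h ^ 2 * Real.cos θ ^ 2 - 1 + 3 * (1 - Real.cos θ ^ 2) * q ^ 2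
  let β₁ : ℝ → ℝ := fun θ => 6 * (1 - Real.cos θ ^ 2) * p * q
  let β₂ : ℝ → ℝ := fun θ => 3 * (1 - Real.cos θ ^ 2) * (p ^ 2 - q ^ 2)
  rw [sqrt_one_sub_div_two hh.le ht, hx, hy, integral_unif_two,
    integral_surface_two_of_trig b c2
    (fun θ => K θ * (1 + ρ / 4 * (α₀ θ * β₀ θ)))
    (fun θ => K θ * (ρ / 4 * (α₁ θ * β₀ θ)))
    (fun θ => K θ * (ρ / 4 * (α₂ θ * β₀ θ + α₀ θ * β₂ θ)))
    (fun θ => K θ * (ρ / 4 * (α₁ θ * β₂ θ)))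
    (fun θ => K θ * (ρ / 4 * (α₂ θ * β₂ θ)))
    0
    (fun θ => K θ * (ρ / 4 * (α₀ θ * β₁ θ)))
    (fun θ => K θ * (ρ / 4 * (α₁ θ * β₁ θ)))
    (fun θ => K θ * (ρ / 4 * (α₂ θ * β₁ θ)))
    (fun θ φ => by
      obtain ⟨h1, h2, h3⟩ := hb θ φ
      simp only [Pi.zero_apply, K, α₀, α₁, α₂, β₀, β₁, β₂]
      rw [h1, h2, h3, abs_frame_sub hh.le, ← Real.sin_sq θ]
      linear_combination |Real.cos θ| * (h / 2) * (ρ / 4)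
        * (3 * (Real.cos θ * m₀ + Real.sin θ * Real.cos φ * m₁) ^ 2 - 1)
        * 3 * Real.sin θ ^ 2 * q ^ 2 * Real.sin_sq_add_cos_sq φ)
    (P := fun z => |z| * (h / 2 * (1 + ρ / 4 * ((1 - 3 * q ^ 2) + 3 / 2 * m₁ ^ 2 * (3 * q ^ 2 - 1)
        - 3 / 2 * (p ^ 2 - q ^ 2) + 27 / 8 * m₁ ^ 2 * (p ^ 2 - q ^ 2)))
      + h / 2 * (ρ / 4 * (3 * m₀ ^ 2 * (3 * q ^ 2 - 1) - (h ^ 2 - 3 * q ^ 2)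
        + 3 / 2 * m₁ ^ 2 * ((h ^ 2 - 3 * q ^ 2) - (3 * q ^ 2 - 1))
        + 3 / 2 * (p ^ 2 - q ^ 2) * (3 * m₀ ^ 2 + 1) - 27 / 4 * m₁ ^ 2 * (p ^ 2 - q ^ 2))) * z ^ 2
      + h / 2 * (ρ / 4 * (3 * m₀ ^ 2 * (h ^ 2 - 3 * q ^ 2) - 3 / 2 * m₁ ^ 2 * (h ^ 2 - 3 * q ^ 2)
        - 9 / 2 * m₀ ^ 2 * (p ^ 2 - q ^ 2) + 27 / 8 * m₁ ^ 2 * (p ^ 2 - q ^ 2))) * z ^ 4))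
      (by fun_prop)
    (fun θ => by simp only [K, α₀, α₂, β₀, β₂]; ring), integral_abs_mul_even_polynomial]
  have e1 : (h * m₀ + p * m₁) ^ 2 + (-h * m₀ + p * m₁) ^ 2
      = 2 * h ^ 2 * m₀ ^ 2 + 2 * p ^ 2 * m₁ ^ 2 := by ring
  have e2 : (h * m₀ + p * m₁) * (-h * m₀ + p * m₁) = p ^ 2 * m₁ ^ 2 - h ^ 2 * m₀ ^ 2 := by ring
  -- Eliminating q² and m₁² uses up the unit-norm relations; what is left is a rational identity in
  -- h, p, m₀ and ρ with h ≠ 0.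
  have hq : q ^ 2 = 1 - h ^ 2 - p ^ 2 := by linarith
  have hm₁ : m₁ ^ 2 = 1 - m₀ ^ 2 := by linarith
  rw [e1, e2, ht, show 1 - (1 - 2 * h ^ 2) = 2 * h ^ 2 by ring, hq, hm₁]
  field_simp
  ring

theorem cvmUnifStat_sphere₁ {n : ℕ} (hn : 1 ≤ n) (hρ : ρ ∈ Icc (-1 : ℝ) 1)
    (μ : Sph 2) (X : Fin n → Sph 2) :
    cvmUnifStat 1 μ ρ X = (3 - 2 * (n : ℝ)) / 6 - ∑ i, phiSphere₁ ρ (dot (X i) μ)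
      + 2 / (n : ℝ) * ∑ i, ∑ j ∈ Finset.Ioi i,
          psiSphere₁ ρ (dot (X i) μ) (dot (X j) μ) (dot (X i) (X j)) :=
  cvmUnifStat_eq_of_kernels hn X continuous_sphPolyNormalized_two_one
    (one_add_mul_sphPolyNormalized_two_one_nonneg hρ μ) (integral_sphPolyNormalized_two_one μ)
    surface_two_dot_eq_null (fun γ _ ht => projCdf_two_one_eq hρ μ γ ht)
    (continuous_sphereCdf₁ μ ρ) (φ := fun x => phiSphere₁ ρ (dot x μ))
    (ψ := fun x y => psiSphere₁ ρ (dot x μ) (dot y μ) (dot x y))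
    (integral_sphereCdf₁ μ) (integral_sphereCdf₁_sq μ) (integral_sphereCdf₁_max μ)

theorem cvmUnifStat_sphere₂ {n : ℕ} (hn : 1 ≤ n) (hρ : ρ ∈ Icc (-1 : ℝ) 1)
    (μ : Sph 2) (X : Fin n → Sph 2) :
    cvmUnifStat 2 μ ρ X = (3 - 2 * (n : ℝ)) / 6 - ∑ i, phiSphere₂ ρ (dot (X i) μ)
      + 2 / (n : ℝ) * ∑ i, ∑ j ∈ Finset.Ioi i,
          psiSphere₂ ρ (dot (X i) μ) (dot (X j) μ) (dot (X i) (X j)) :=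
  cvmUnifStat_eq_of_kernels hn X continuous_sphPolyNormalized_two_two
    (one_add_mul_sphPolyNormalized_two_two_nonneg hρ μ) (integral_sphPolyNormalized_two_two μ)
    surface_two_dot_eq_null (fun γ _ ht => projCdf_two_two_eq hρ μ γ ht)
    (continuous_sphereCdf₂ μ ρ) (φ := fun x => phiSphere₂ ρ (dot x μ))
    (ψ := fun x y => psiSphere₂ ρ (dot x μ) (dot y μ) (dot x y))
    (integral_sphereCdf₂ μ) (integral_sphereCdf₂_sq μ) (integral_sphereCdf₂_max μ)

end SphereCardioid

end SphCardioid

end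

theorem theorem7 (n : ℕ) (hn : 1 ≤ n) (ρ : ℝ) (hρ : ρ ∈ Set.Icc (-1 : ℝ) 1) :
    (∀ k : ℕ, 1 ≤ k → ∀ (μ : SphCardioid.Sph 1) (X : Fin n → SphCardioid.Sph 1),
      SphCardioid.cvmUnifStat k μ ρ X =
        (3 - 2 * (n : ℝ)) / 6
          - ∑ i, SphCardioid.phiCircle k ρ (SphCardioid.dot (X i) μ)
          + 2 / (n : ℝ) * ∑ i, ∑ j ∈ Finset.Ioi i,
              SphCardioid.psiCircle k ρ (SphCardioid.dot (X i) μ) (SphCardioid.dot (X j) μ)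
                (SphCardioid.dot (X i) (X j))) ∧
    (∀ (μ : SphCardioid.Sph 2) (X : Fin n → SphCardioid.Sph 2),
      SphCardioid.cvmUnifStat 1 μ ρ X =
        (3 - 2 * (n : ℝ)) / 6
          - ∑ i, SphCardioid.phiSphere₁ ρ (SphCardioid.dot (X i) μ)
          + 2 / (n : ℝ) * ∑ i, ∑ j ∈ Finset.Ioi i,
              SphCardioid.psiSphere₁ ρ (SphCardioid.dot (X i) μ) (SphCardioid.dot (X j) μ)
                (SphCardioid.dot (X i) (X j))) ∧
    (∀ (μ : SphCardioid.Sph 2) (X : Fin n → SphCardioid.Sph 2),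
      SphCardioid.cvmUnifStat 2 μ ρ X =
        (3 - 2 * (n : ℝ)) / 6
          - ∑ i, SphCardioid.phiSphere₂ ρ (SphCardioid.dot (X i) μ)
          + 2 / (n : ℝ) * ∑ i, ∑ j ∈ Finset.Ioi i,
              SphCardioid.psiSphere₂ ρ (SphCardioid.dot (X i) μ) (SphCardioid.dot (X j) μ)
                (SphCardioid.dot (X i) (X j))) :=
  ⟨fun _ hk μ X => SphCardioid.cvmUnifStat_circle hn hρ hk μ X,
    fun μ X => SphCardioid.cvmUnifStat_sphere₁ hn hρ μ X,
    fun μ X => SphCardioid.cvmUnifStat_sphere₂ hn hρ μ X⟩
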